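/- **Setting.** Let $n\ge 2$, $0<\kappa<1$, $0<c_1<c_2$. Let $\Omega\subset S^{n-1}$ be a domain (relatively open and connected), $\Sigma\subset\mathbb R^n$ a Borel set (the target), $\Gamma=\{rx: x\in\Omega,\ c_1\le r\le c_2\}$, and let $H^{n-1}$ be the $(n-1)$-dimensional Hausdorff measure. For $X\in\Gamma$ write $x=X/|X|$. *Ovals.* For $x\in S^{n-1}$ put $$\rho(x,Y,b)=\frac{b-\kappa^2 x\cdot Y-\sqrt{(b-\kappa^2x\cdot Y)^2-(1-\kappa^2)(b^2-\kappa^2|Y|^2)}}{1-\kappa^2},\qquad h(x,Y,X_0)=\rho\big(x,Y,|X_0|+\kappa|X_0-Y|\big).$$ *Curves.* For $x_0,\bar m,\hat m\in S^{n-1}$ with $\bar m\cdot x_0\ge\kappa$, $\hat m\cdot x_0\ge\kappa$ and $\lambda\in[0,1]$ let $\xi=(1-\lambda)\bar m+\lambda\hat m-\frac1\kappa x_0$, $$\beta(\lambda)=\frac{-x_0\cdot\xi-\sqrt{(x_0\cdot\xi)^2-(1-\kappa^2)|\xi|^2}}{\kappa|\xi|^2},\qquad m(\lambda)=\tfrac1\kappa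 x_0+\beta(\lambda)\,\xi,$$ and $[\bar m,\hat m]_{x_0}=\{m(\lambda):0\le\lambda\le1\}\subset S^{n-1}$. *Structural hypotheses.* * **H.A** (a) $x\cdot\frac{Y-X}{|Y-X|}\ge\kappa$ for all $X\in\Gamma$, $Y\in\Sigma$. (b) For each $X\in\Gamma$ there are a set $E(X)\subset\{m\in S^{n-1}:m\cdot x\ge\kappa\}$ and a continuous $s_X:E(X)\to(0,\infty)$ with $\Sigma=\{X+s_X(m)m:m\in E(X)\}$, and $[\bar m,\hat m]_x\subset E(X)$ for all $\bar m,\hat m\in E(X)$. (c) There is $C>0$ with $|s_X(m_1)-s_X(m_2)|\le C|m_1-m_2|$ for all $X\in\Gamma$, $m_1,m_2\in E(X)$. * **H.B** $\frac{|X|}{|Y-X|}\le\kappa\big(\sqrt{1+(1+\kappa)^{-2}}-1\big)$ for all $X\in\Gamma$, $Y\in\Sigma$. * **H.C** There is $0\le\mu_1<\kappa$ such that for all $X_0\in\Gamma$, $\bar m,\hat m\in E(X_0)$, $\lambda\in[0,1]$, with $\beta(\lambda)$, $m(\lambda)$ taken for $x_0=X_0/|X_0|$, $$\frac1{s_{X_0}(m(\lambda))}+\frac{\mu_1}{|X_0|}\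 \ge\ (1-\lambda)\beta(\lambda)\Big(\frac1{s_{X_0}(\bar m)}+\frac{\mu_1}{|X_0|}\Big)+\lambda\beta(\lambda)\Big(\frac1{s_{X_0}(\hat m)}+\frac{\mu_1}{|X_0|}\Big).$$ * **H.D** There are $t_0,C>0$ such that for all $X_0\in\Gamma$, $\bar Y,\hat Y\in\Sigma$ and $0<t\le t_0$ $$H^{n-1}\Big(N_t\big(\{Y(\lambda):\tfrac14\le\lambda\le\tfrac34\}\big)\cap\Sigma\Big)\ge C\,t^{\,n-2}\,|\bar Y-\hat Y|,$$ where $N_t$ is the $t$-neighborhood in $\mathbb R^n$, $Y(\lambda)=X_0+s_{X_0}(m(\lambda))\,m(\lambda)$, and $m(\lambda)$ is taken for $x_0=\frac{X_0}{|X_0|}$, $\bar m=\frac{\bar Y-X_0}{|\bar Y-X_0|}$, $\hat m=\frac{\hat Y-X_0}{|\hat Y-X_0|}$. *Weak solutions.* A function $u:\Omega\to[c_1,c_2]$ is a refractor from $\Omega$ to $\Sigma$ if for each $x_0\in\Omega$ the set $$\partial u(x_0)=\{Y\in\Sigma: u(x)\ge h(x,Y,u(x_0)x_0)\ \text{for all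 }x\in\Omega\}$$ is non-empty. For $B\subset\Sigma$ let $\mathcal T_u(B)=\{x\in\Omega:\partial u(x)\cap B\ne\emptyset\}$, and for $A\subset\Omega$ let $\partial u(A)=\bigcup_{x\in A}\partial u(x)$. Let $\mu=f\,dx$, with $dx$ the surface measure on $\Omega$ and $f>0$ a.e., and let $\nu$ be a Borel measure on $\Sigma$. A weak solution is a refractor $u$ with $\mu(\mathcal T_u(B))=\nu(B)$ for all Borel $B\subset\Sigma$ (in particular $\int_\Omega f\,dx=\nu(\Sigma)$). **Theorem.** Assume H.A, H.B, H.C, H.D, and that $\Sigma$ is differentiable, i.e. it has a tangent hyperplane at each of its points $Y$: there is a unit vector $N$ with $(Z-Y)\cdot N=o(|Z-Y|)$ as $Z\to Y$, $Z\in\Sigma$. Assume $f\in L^\infty(\Omega)$, $\nu\ll H^{n-1}$, and that on $\Sigma$ one has $dH^{n-1}=g\,d\nu$ with $g$ measurable and $0\le g\le\alpha$ a.e. for a constant $\alpha$. Then every weak solution $u$ satisfies the following. 1. There is a constant $C$ such that $H^{n-1}\big(\partial u(B_\sigma\cap S^{n-1})\big)\le C\sigma^{n-1}$ for every ball $B_\sigma\subset\mathbb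 R^n$ of radius $\sigma$ with $B_\sigma\cap S^{n-1}\subset\Omega$. 2. $u\in C^{1,\gamma}_{\rm loc}(\Omega)$ with $\gamma=\frac1{4n-5}$: the function $\tilde u(X)=u(X/|X|)$ is differentiable at every point of $\Omega$, and for every compact $K\subset\Omega$ there is $C_K$ with $|\nabla\tilde u(x)-\nabla\tilde u(y)|\le C_K|x-y|^{\gamma}$ for all $x,y\in K$. -/

import Mathlib

open MeasureTheory Set
open scoped ENNReal

noncomputable section

namespace NearField

/-- Euclidean space of dimension `n`. -/
abbrev Rn (n : ℕ) := EuclideanSpace ℝ (Fin n)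

/-- The unit sphere of `ℝⁿ`. -/
def unitSphere (n : ℕ) : Set (Rn n) := Metric.sphere 0 1

/-- The `(n-1)`-dimensional Hausdorff measure on `ℝⁿ`. Its restriction to the unit sphere is, up to
a constant factor that depends only on `n`, the surface measure `dx`. -/
def hausdorff (n : ℕ) : Measure (Rn n) := μH[(n : ℝ) - 1]

variable {n : ℕ}

/-- The polar radius `ρ(x, Y, b)` of the Descartes oval `{X : |X| + κ |X - Y| = b}`. -/
def ovalRadius (κ : ℝ) (x Y : Rn n) (b : ℝ) : ℝ :=
  (b - κ ^ 2 * inner ℝ x Y -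
    √((b - κ ^ 2 * inner ℝ x Y) ^ 2 - (1 - κ ^ 2) * (b ^ 2 - κ ^ 2 * ‖Y‖ ^ 2))) / (1 - κ ^ 2)

/-- `h(x, Y, X₀)`: the polar radius of the oval with focus `Y` that passes through `X₀`. -/
def ovalThrough (κ : ℝ) (x Y X₀ : Rn n) : ℝ :=
  ovalRadius κ x Y (‖X₀‖ + κ * ‖X₀ - Y‖)

/-- `Γ = {r x : x ∈ Ω, c₁ ≤ r ≤ c₂}`. -/
def Gam (Ω : Set (Rn n)) (c₁ c₂ : ℝ) : Set (Rn n) :=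
  {X | ∃ x ∈ Ω, ∃ r : ℝ, c₁ ≤ r ∧ r ≤ c₂ ∧ X = r • x}

/-- The unit vector in the direction of `v`. -/
def dir (v : Rn n) : Rn n := ‖v‖⁻¹ • v

/-- The vector `ξ = m_l - x₀/κ`, with `m_l = (1-l) m₁ + l m₂`. -/
def chordVec (κ : ℝ) (x₀ m₁ m₂ : Rn n) (l : ℝ) : Rn n :=
  ((1 - l) • m₁ + l • m₂) - κ⁻¹ • x₀

/-- The coefficient `β(l)`: the smaller root of `|x₀/κ + β ξ| = 1`. -/
def betaCoef (κ : ℝ) (x₀ m₁ m₂ : Rn n) (l : ℝ) : ℝ :=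
  (-(inner ℝ x₀ (chordVec κ x₀ m₁ m₂ l)) -
      √((inner ℝ x₀ (chordVec κ x₀ m₁ m₂ l)) ^ 2 -
        (1 - κ ^ 2) * ‖chordVec κ x₀ m₁ m₂ l‖ ^ 2)) /
    (κ * ‖chordVec κ x₀ m₁ m₂ l‖ ^ 2)

/-- The parametrization `m(l)`, `0 ≤ l ≤ 1`, of the curve `[m₁, m₂]_{x₀}` in which the sphere meets
the triangle with vertices `m₁`, `m₂`, `x₀/κ`. -/
def curvePt (κ : ℝ) (x₀ m₁ m₂ : Rn n) (l : ℝ) : Rn n :=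
  κ⁻¹ • x₀ + betaCoef κ x₀ m₁ m₂ l • chordVec κ x₀ m₁ m₂ l

/-- The point `Y(l) = X₀ + s_{X₀}(m(l)) m(l)` of the curve `[Y₁, Y₂]_{X₀}` in the target. -/
def targetCurvePt (κ : ℝ) (s : Rn n → Rn n → ℝ) (X₀ Y₁ Y₂ : Rn n) (l : ℝ) : Rn n :=
  X₀ + s X₀ (curvePt κ (dir X₀) (dir (Y₁ - X₀)) (dir (Y₂ - X₀)) l) •
    curvePt κ (dir X₀) (dir (Y₁ - X₀)) (dir (Y₂ - X₀)) l

/-- Hypothesis H.A on the target `S`: every point of `S` can be reached by refraction from every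
point of `Γ`, and, seen from `X ∈ Γ`, the target is the graph of `s X` over the set `E X` of
directions; `E X` is convex with respect to the curves `[m₁, m₂]_x`, and the functions `s X` are
uniformly Lipschitz. -/
structure HypA (κ c₁ c₂ : ℝ) (Ω S : Set (Rn n)) (E : Rn n → Set (Rn n))
    (s : Rn n → Rn n → ℝ) : Prop where
  refracts : ∀ X ∈ Gam Ω c₁ c₂, ∀ Y ∈ S, κ ≤ inner ℝ (dir X) (dir (Y - X))
  directions : ∀ X ∈ Gam Ω c₁ c₂, E X ⊆ {m | m ∈ unitSphere n ∧ κ ≤ inner ℝ m (dir X)}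
  pos : ∀ X ∈ Gam Ω c₁ c₂, ∀ m ∈ E X, 0 < s X m
  cont : ∀ X ∈ Gam Ω c₁ c₂, ContinuousOn (s X) (E X)
  graph : ∀ X ∈ Gam Ω c₁ c₂, S = (fun m => X + s X m • m) '' E X
  convex : ∀ X ∈ Gam Ω c₁ c₂, ∀ m₁ ∈ E X, ∀ m₂ ∈ E X, ∀ l ∈ Icc (0 : ℝ) 1,
    curvePt κ (dir X) m₁ m₂ l ∈ E X
  lipschitz : ∃ C : ℝ, 0 < C ∧ ∀ X ∈ Gam Ω c₁ c₂, ∀ m₁ ∈ E X, ∀ m₂ ∈ E X,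
    |s X m₁ - s X m₂| ≤ C * ‖m₁ - m₂‖

/-- Hypothesis H.B: the target is far away from `Γ`. -/
def HypB (κ c₁ c₂ : ℝ) (Ω S : Set (Rn n)) : Prop :=
  ∀ X ∈ Gam Ω c₁ c₂, ∀ Y ∈ S, ‖X‖ / ‖Y - X‖ ≤ κ * (√(1 + ((1 + κ) ^ 2)⁻¹) - 1)

/-- Hypothesis H.C: the concavity condition on the functions `s X₀`. -/
def HypC (κ c₁ c₂ : ℝ) (Ω : Set (Rn n)) (E : Rn n → Set (Rn n)) (s : Rn n → Rn n → ℝ) : Prop :=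
  ∃ μ : ℝ, 0 ≤ μ ∧ μ < κ ∧
    ∀ X₀ ∈ Gam Ω c₁ c₂, ∀ m₁ ∈ E X₀, ∀ m₂ ∈ E X₀, ∀ l ∈ Icc (0 : ℝ) 1,
      (1 - l) * betaCoef κ (dir X₀) m₁ m₂ l * (1 / s X₀ m₁ + μ / ‖X₀‖) +
          l * betaCoef κ (dir X₀) m₁ m₂ l * (1 / s X₀ m₂ + μ / ‖X₀‖) ≤
        1 / s X₀ (curvePt κ (dir X₀) m₁ m₂ l) + μ / ‖X₀‖

/-- Hypothesis H.D: neighbourhoods of the middle half of each curve `[Y₁, Y₂]_{X₀}` occupy a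
sufficiently large part of the target. -/
def HypD (κ c₁ c₂ : ℝ) (Ω S : Set (Rn n)) (s : Rn n → Rn n → ℝ) : Prop :=
  ∃ μ₀ C : ℝ, 0 < μ₀ ∧ 0 < C ∧
    ∀ X₀ ∈ Gam Ω c₁ c₂, ∀ Y₁ ∈ S, ∀ Y₂ ∈ S, ∀ μ : ℝ, 0 < μ → μ ≤ μ₀ →
      ENNReal.ofReal (C * μ ^ (n - 2) * ‖Y₁ - Y₂‖) ≤
        hausdorff n
          (Metric.thickening μ (targetCurvePt κ s X₀ Y₁ Y₂ '' Icc (1 / 4 : ℝ) (3 / 4)) ∩ S)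

/-- The surface `S` is differentiable: at each of its points `Y` it has a tangent hyperplane
`Y + N^⊥`, that is, `⟨Z - Y, N⟩ = o(|Z - Y|)` as `Z → Y` in `S`. -/
def DifferentiableSurface (S : Set (Rn n)) : Prop :=
  ∀ Y ∈ S, ∃ N : Rn n, ‖N‖ = 1 ∧
    (fun Z : Rn n => inner ℝ (Z - Y) N) =o[nhdsWithin Y S] (fun Z : Rn n => Z - Y)

/-- `∂u(x₀)`: the points `Y` of the target such that the oval with focus `Y` through
`X₀ = u(x₀) x₀` supports `u` from below on `Ω`. -/
def subdiff (κ : ℝ) (Ω S : Set (Rn n)) (u : Rn n → ℝ) (x₀ : Rn n) : Set (Rn n) :=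
  {Y | Y ∈ S ∧ ∀ x ∈ Ω, ovalThrough κ x Y (u x₀ • x₀) ≤ u x}

/-- `u : Ω → [c₁, c₂]` is a refractor from `Ω` to `S`. Only the values of `u` on `Ω` matter. -/
def IsRefractor (κ c₁ c₂ : ℝ) (Ω S : Set (Rn n)) (u : Rn n → ℝ) : Prop :=
  (∀ x ∈ Ω, u x ∈ Icc c₁ c₂) ∧ ∀ x ∈ Ω, (subdiff κ Ω S u x).Nonempty

/-- The tracing map `T_u(B) = {x ∈ Ω : ∂u(x) ∩ B ≠ ∅}`. -/
def tracing (κ : ℝ) (Ω S : Set (Rn n)) (u : Rn n → ℝ) (B : Set (Rn n)) : Set (Rn n) :=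
  {x | x ∈ Ω ∧ ∃ Y ∈ B, Y ∈ subdiff κ Ω S u x}

/-- The measure `f(x) dx` on `Ω`. -/
def sourceMeasure (Ω : Set (Rn n)) (f : Rn n → ℝ) : Measure (Rn n) :=
  ((hausdorff n).restrict Ω).withDensity (fun x => ENNReal.ofReal (f x))

/-- `u` is a weak solution of the refractor problem with source density `f` and target
measure `ν`. -/
def IsWeakSolution (κ c₁ c₂ : ℝ) (Ω S : Set (Rn n)) (f : Rn n → ℝ) (ν : Measure (Rn n))
    (u : Rn n → ℝ) : Prop :=
  IsRefractor κ c₁ c₂ Ω S u ∧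
    ∀ B : Set (Rn n), MeasurableSet B → B ⊆ S →
      sourceMeasure Ω f (tracing κ Ω S u B) = ν B

/-- `H^{n-1}(∂u(B_σ ∩ S^{n-1})) ≤ C σ^{n-1}` for all balls `B_σ` with `B_σ ∩ S^{n-1} ⊆ Ω`. -/
def MeasureCondition (κ : ℝ) (Ω S : Set (Rn n)) (u : Rn n → ℝ) : Prop :=
  ∃ C : ℝ, ∀ (c : Rn n) (σ : ℝ), 0 < σ → Metric.ball c σ ∩ unitSphere n ⊆ Ω →
    hausdorff n (⋃ x ∈ Metric.ball c σ ∩ unitSphere n, subdiff κ Ω S u x) ≤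
      ENNReal.ofReal (C * σ ^ (n - 1))

/-- The extension of `u` that is homogeneous of degree zero, `X ↦ u(X/|X|)`. -/
def radialExt (u : Rn n → ℝ) (X : Rn n) : ℝ := u (dir X)

/-- `u ∈ C^{1,a}_loc(Ω)` for `Ω` open in the unit sphere: the extension `X ↦ u(X/|X|)` is
differentiable at the points of `Ω`, and its derivative (the tangential gradient of `u`) is
Hölder continuous with exponent `a` on each compact subset of `Ω`. -/
def C1HolderLoc (a : ℝ) (Ω : Set (Rn n)) (u : Rn n → ℝ) : Prop :=
  (∀ x ∈ Ω, DifferentiableAt ℝ (radialExt u) x) ∧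
    ∀ K : Set (Rn n), K ⊆ Ω → IsCompact K → ∃ C : ℝ, ∀ x ∈ K, ∀ y ∈ K,
      ‖fderiv ℝ (radialExt u) x - fderiv ℝ (radialExt u) y‖ ≤ C * ‖x - y‖ ^ a

end NearField

end

noncomputable section

namespace NearField

/-! ### Ovals as level sets of the optical path, and the curves on the sphere -/

section

variable {n : ℕ}

/-! Write `G(X, Y) = |X| + κ|X - Y|` (`opticalPath`). Then `Y ∈ ∂u(x₀)` exactly when `Y ∈ Σ` and
`x₀` minimizes `x ↦ G(u(x) x, Y)` over `Ω` (`mem_subdiff_iff`), so the ovals drop out and a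
refractor is studied through these minima.

Measure bound. The dual potential `φ(Y) = min G(u(x) x, Y)` is Lipschitz on the set of points that
support `u` at two places. In a bi-Lipschitz chart of that set, Rademacher's theorem differentiates
both `φ` and the target. At such a point the two incoming rays have equal tangential components. No
ray from the connected set `Γ` is tangent to the target, which forces the rays to agree, and then
their starting points agree as well. Hence doubly supporting points form a null set
(`hausdorff_multiSupport`), `T_u(∂u(B))` lies in `B` up to a null set, and the bounds on `f` and `g`
transfer the size of a spherical cap to its image (`IsWeakSolution.measureCondition`).

Regularity. By H.B and H.C, if `X₀` has the smaller optical path to `Y₁` and `Y₂` than `X`, then on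
the middle half of `[Y₁, Y₂]_{X₀}` it wins by at least `c |Y₁ - Y₂|² |x - x₀|²`
(`exists_opticalPath_gain`). Take `Yᵢ ∈ ∂u(xᵢ)`, `δ = |x₁ - x₂|`, `L = |Y₁ - Y₂|`. At `x₁` the path
to `Y₂` is minimal up to `C δ L`. So if `L η² ≳ δ`, every target point within about `L² η` of the
middle half supports `u` somewhere in the ball of radius `2η` about `x₁`. H.D and the measure bound
give `(L² η)^(n-2) L ≲ η^(n-1)`, that is `L^(2n-3) ≲ η`, and `η² ~ δ / L` yields `L^(4n-5) ≲ δ`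
(`exists_subdiff_holder`). The gradient of `u` is an explicit Lipschitz function of `x`, `u(x)` and
the refracted direction, so it inherits the exponent. -/

lemma norm_eq_one_of_mem_unitSphere {x : Rn n} (hx : x ∈ unitSphere n) : ‖x‖ = 1 := by
  simpa [unitSphere] using hx

/-- The optical path length from the origin to `Y` through `X`, whose level sets are the ovals. -/
def opticalPath (κ : ℝ) (X Y : Rn n) : ℝ := ‖X‖ + κ * ‖X - Y‖

lemma norm_smul_sub_sq {x Y : Rn n} (hx : ‖x‖ = 1) (t : ℝ) :
    ‖t • x - Y‖ ^ 2 = t ^ 2 - 2 * t * inner ℝ x Y + ‖Y‖ ^ 2 := by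
  rw [norm_sub_sq_real, norm_smul, hx, real_inner_smul_left]
  simp only [Real.norm_eq_abs, mul_one, sq_abs]; ring

/-- Put `N = ‖t • x - Y‖`. The claim reads `p ≤ √D` with `D = p ^ 2 - (1 - κ ^ 2) * ((b - t) ^ 2 - κ
^ 2 * N ^ 2)`. Since `|⟨x, t • x - Y⟩| ≤ N`, the sign of `p` is that of `b - t` whenever the last
factor is positive; hence no condition on `b` or on the sign of `D` is needed. -/
lemma ovalRadius_le_iff {κ : ℝ} (hκ0 : 0 < κ) (hκ1 : κ < 1) {x : Rn n} (hx : ‖x‖ = 1)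
    (Y : Rn n) (b t : ℝ) :
    ovalRadius κ x Y b ≤ t ↔ b ≤ t + κ * ‖t • x - Y‖ := by
  have hk : 0 < 1 - κ ^ 2 := by nlinarith
  have hsq := norm_smul_sub_sq (Y := Y) hx t
  have hcs : |inner ℝ x (t • x - Y)| ≤ ‖t • x - Y‖ := by
    simpa [hx] using abs_real_inner_le_norm x (t • x - Y)
  have hin : inner ℝ x (t • x - Y) = t - inner ℝ x Y := by
    rw [inner_sub_right, real_inner_smul_right, real_inner_self_eq_norm_sq, hx]; ring
  rw [hin, abs_le] at hcs
  have hN := norm_nonneg (t • x - Y)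
  set N := ‖t • x - Y‖
  set a : ℝ := inner ℝ x Y
  rw [ovalRadius, div_le_iff₀ hk]
  set D := (b - κ ^ 2 * a) ^ 2 - (1 - κ ^ 2) * (b ^ 2 - κ ^ 2 * ‖Y‖ ^ 2) with hD
  have hDe : D = (b - κ ^ 2 * a - (1 - κ ^ 2) * t) ^ 2 -
      (1 - κ ^ 2) * ((b - t) ^ 2 - κ ^ 2 * N ^ 2) := by rw [hD, hsq]; ring
  have hκκ : κ ^ 2 * N ≤ κ * N := mul_le_mul_of_nonneg_right (by nlinarith) hN
  have h1 := mul_le_mul_of_nonneg_left hcs.1 (sq_nonneg κ)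
  have h2 := mul_le_mul_of_nonneg_left hcs.2 (sq_nonneg κ)
  constructor
  · intro h
    by_contra! hlt
    have hq : 0 < (b - t) ^ 2 - κ ^ 2 * N ^ 2 := by nlinarith [mul_nonneg hκ0.le hN]
    have hp : 0 < b - κ ^ 2 * a - (1 - κ ^ 2) * t := by nlinarith
    have : √D < b - κ ^ 2 * a - (1 - κ ^ 2) * t := by
      rw [Real.sqrt_lt' hp, hDe]; nlinarith [mul_pos hk hq]
    linarith
  · intro h
    have : b - κ ^ 2 * a - (1 - κ ^ 2) * t ≤ √D := by
      by_cases hq : (b - t) ^ 2 - κ ^ 2 * N ^ 2 ≤ 0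
      · apply Real.le_sqrt_of_sq_le
        rw [hDe]; nlinarith
      · push Not at hq
        have hbt : κ * N < t - b := by
          by_contra! h'
          nlinarith
        refine le_trans ?_ (Real.sqrt_nonneg D)
        nlinarith
    linarith

lemma mem_subdiff_iff {κ c₁ c₂ : ℝ} (hκ0 : 0 < κ) (hκ1 : κ < 1) (hc₁ : 0 < c₁)
    {Ω S : Set (Rn n)} (hΩ : Ω ⊆ unitSphere n) {u : Rn n → ℝ}
    (hu : ∀ x ∈ Ω, u x ∈ Icc c₁ c₂) {x₀ Y : Rn n} :
    Y ∈ subdiff κ Ω S u x₀ ↔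
      Y ∈ S ∧ ∀ x ∈ Ω, opticalPath κ (u x₀ • x₀) Y ≤ opticalPath κ (u x • x) Y := by
  refine and_congr_right fun _ => forall₂_congr fun x hx => ?_
  have hx1 := norm_eq_one_of_mem_unitSphere (hΩ hx)
  have hux : 0 ≤ u x := hc₁.le.trans (hu x hx).1
  rw [ovalThrough, ovalRadius_le_iff hκ0 hκ1 hx1, opticalPath, opticalPath, norm_smul (u x) x, hx1,
    Real.norm_of_nonneg hux, mul_one]

lemma opticalPath_sub_le {κ : ℝ} (hκ0 : 0 ≤ κ) (X Y Z : Rn n) :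
    opticalPath κ X Y - opticalPath κ X Z ≤ κ * ‖Y - Z‖ := by
  have h : ‖X - Y‖ ≤ ‖X - Z‖ + ‖Y - Z‖ := by
    rw [norm_sub_rev Y Z]; exact norm_sub_le_norm_sub_add_norm_sub X Z Y
  unfold opticalPath
  nlinarith

/-- Compare, at `x` and `y`, the optical paths to a point supporting at `x`: the difference `u x - u
y` is at most `κ` times the displacement, and `κ < 1` allows its radial part to be absorbed. -/
lemma abs_refractor_sub_le {κ c₁ c₂ : ℝ} (hκ0 : 0 < κ) (hκ1 : κ < 1) (hc₁ : 0 < c₁)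
    {Ω S : Set (Rn n)} (hΩ : Ω ⊆ unitSphere n) {u : Rn n → ℝ}
    (hu : IsRefractor κ c₁ c₂ Ω S u) {x y : Rn n} (hx : x ∈ Ω) (hy : y ∈ Ω) :
    |u x - u y| ≤ κ * c₂ / (1 - κ) * ‖x - y‖ := by
  have key : ∀ x ∈ Ω, ∀ y ∈ Ω, u x - u y ≤ κ * c₂ / (1 - κ) * ‖x - y‖ := by
    intro x hx y hy
    obtain ⟨Y, hY⟩ := hu.2 x hx
    rw [mem_subdiff_iff hκ0 hκ1 hc₁ hΩ hu.1] at hY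
    have h := hY.2 y hy
    have hx1 := norm_eq_one_of_mem_unitSphere (hΩ hx)
    have hy1 := norm_eq_one_of_mem_unitSphere (hΩ hy)
    have hux : 0 < u x := hc₁.trans_le (hu.1 x hx).1
    have huy : 0 < u y := hc₁.trans_le (hu.1 y hy).1
    rw [opticalPath, opticalPath, norm_smul, norm_smul, hx1, hy1, Real.norm_of_nonneg hux.le,
      Real.norm_of_nonneg huy.le] at h
    have h1 : ‖u y • y - Y‖ ≤ ‖u x • x - Y‖ + ‖u y • y - u x • x‖ := by
      have := norm_add_le (u x • x - Y) (u y • y - u x • x)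
      simpa using this
    have h2 : ‖u y • y - u x • x‖ ≤ |u x - u y| + u x * ‖x - y‖ := by
      have : u y • y - u x • x = (u y - u x) • y + u x • (y - x) := by module
      rw [this]
      refine (norm_add_le _ _).trans ?_
      rw [norm_smul, norm_smul, hy1, Real.norm_of_nonneg hux.le, norm_sub_rev y x,
        Real.norm_eq_abs, abs_sub_comm]
      simp
    rcases le_total (u x) (u y) with hle | hle
    · exact (sub_nonpos.2 hle).trans (mul_nonneg (div_nonneg (mul_nonneg hκ0.le
        (hux.le.trans (hu.1 x hx).2)) (by linarith)) (norm_nonneg _))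
    · rw [abs_of_nonneg (by linarith)] at h2
      rw [div_mul_eq_mul_div, le_div_iff₀ (by linarith)]
      have h3 : u x * ‖x - y‖ ≤ c₂ * ‖x - y‖ :=
        mul_le_mul_of_nonneg_right (hu.1 x hx).2 (norm_nonneg _)
      nlinarith
  rw [abs_le]
  refine ⟨?_, key x hx y hy⟩
  have := key y hy x hx
  rw [norm_sub_rev] at this
  linarith

section Curve

variable {κ : ℝ} {x₀ m₁ m₂ : Rn n} {l : ℝ}

lemma norm_chord_sq (h1 : ‖m₁‖ = 1) (h2 : ‖m₂‖ = 1) :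
    ‖(1 - l) • m₁ + l • m₂‖ ^ 2 = 1 - l * (1 - l) * ‖m₁ - m₂‖ ^ 2 := by
  rw [norm_add_sq_real, norm_sub_sq_real, norm_smul, norm_smul, real_inner_smul_left,
    real_inner_smul_right, h1, h2]
  simp only [Real.norm_eq_abs, mul_one, sq_abs]; ring

lemma norm_chord_le (h1 : ‖m₁‖ = 1) (h2 : ‖m₂‖ = 1) (hl : l ∈ Icc (0 : ℝ) 1) :
    ‖(1 - l) • m₁ + l • m₂‖ ≤ 1 := by
  have := norm_chord_sq (l := l) h1 h2
  have h3 : 0 ≤ l * (1 - l) * ‖m₁ - m₂‖ ^ 2 :=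
    mul_nonneg (mul_nonneg hl.1 (by linarith [hl.2])) (sq_nonneg _)
  exact (sq_le_one_iff₀ (norm_nonneg _)).1 (by linarith)

/-- The quadratic `|x₀/κ + β ξ|² - 1` is positive at `β = 0` and, since the chord lies in the unit
ball, nonpositive at `β = 1`. -/
lemma betaCoef_mem_Icc (hκ0 : 0 < κ) (hκ1 : κ < 1) (hx : ‖x₀‖ = 1) (h1 : ‖m₁‖ = 1)
    (h2 : ‖m₂‖ = 1) (hl : l ∈ Icc (0 : ℝ) 1) : betaCoef κ x₀ m₁ m₂ l ∈ Icc (0 : ℝ) 1 := by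
  have hml := norm_chord_le h1 h2 hl
  have hk : 1 < κ⁻¹ := (one_lt_inv₀ hκ0).2 hκ1
  have hcv : (1 - l) • m₁ + l • m₂ = κ⁻¹ • x₀ + chordVec κ x₀ m₁ m₂ l := by
    simp [chordVec]
  rw [betaCoef]
  have ha : inner ℝ x₀ (chordVec κ x₀ m₁ m₂ l) ≤ 0 := by
    have h3 : inner ℝ x₀ ((1 - l) • m₁ + l • m₂) ≤ 1 := by
      refine (real_inner_le_norm _ _).trans ?_
      rw [hx, one_mul]; exact hml
    rw [hcv, inner_add_right, real_inner_smul_right, real_inner_self_eq_norm_sq, hx] at h3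
    linarith
  have hq : κ⁻¹ ^ 2 + 2 * κ⁻¹ * inner ℝ x₀ (chordVec κ x₀ m₁ m₂ l) +
      ‖chordVec κ x₀ m₁ m₂ l‖ ^ 2 ≤ 1 := by
    have h3 : ‖(1 - l) • m₁ + l • m₂‖ ^ 2 ≤ 1 := pow_le_one₀ (norm_nonneg _) hml
    rw [hcv, norm_add_sq_real, norm_smul, hx, real_inner_smul_left, Real.norm_of_nonneg
      (inv_nonneg.2 hκ0.le)] at h3
    linarith
  have hξ : 0 < ‖chordVec κ x₀ m₁ m₂ l‖ := by
    rw [norm_pos_iff]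
    intro h0
    rw [h0, add_zero] at hcv
    rw [hcv, norm_smul, hx, Real.norm_of_nonneg (inv_nonneg.2 hκ0.le)] at hml
    linarith
  set a : ℝ := inner ℝ x₀ (chordVec κ x₀ m₁ m₂ l)
  set N := ‖chordVec κ x₀ m₁ m₂ l‖
  have hq' : 1 + 2 * κ * a + κ ^ 2 * N ^ 2 ≤ κ ^ 2 := by
    have := mul_le_mul_of_nonneg_left hq (sq_nonneg κ)
    field_simp at this
    linarith
  have hk2 : 0 ≤ 1 - κ ^ 2 := by nlinarith
  have hden : 0 < κ * N ^ 2 := by positivity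
  constructor
  · apply div_nonneg _ hden.le
    have : √(a ^ 2 - (1 - κ ^ 2) * N ^ 2) ≤ -a := by
      apply Real.sqrt_le_iff.2 ⟨by linarith, ?_⟩
      nlinarith [mul_nonneg hk2 (sq_nonneg N)]
    linarith
  · rw [div_le_one hden]
    have : -a - κ * N ^ 2 ≤ √(a ^ 2 - (1 - κ ^ 2) * N ^ 2) := by
      apply Real.le_sqrt_of_sq_le
      nlinarith [sq_nonneg N]
    linarith

lemma curvePt_eq : curvePt κ x₀ m₁ m₂ l =
    (betaCoef κ x₀ m₁ m₂ l * (1 - l)) • m₁ + (betaCoef κ x₀ m₁ m₂ l * l) • m₂ +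
      ((1 - betaCoef κ x₀ m₁ m₂ l) * κ⁻¹) • x₀ := by
  rw [curvePt, chordVec]; module

/-- The chord sinks below the sphere by an amount quadratic in `|m₁ - m₂|`, while the curve point is
only `(1 - β)|ξ|` away from it. This gap is the source of strictness in the quasiconvexity. -/
lemma norm_sub_sq_le_one_sub_betaCoef (hκ0 : 0 < κ) (hκ1 : κ < 1) (hx : ‖x₀‖ = 1)
    (h1 : ‖m₁‖ = 1) (h2 : ‖m₂‖ = 1) (hl : l ∈ Icc (0 : ℝ) 1)
    (hm : ‖curvePt κ x₀ m₁ m₂ l‖ = 1) :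
    l * (1 - l) * ‖m₁ - m₂‖ ^ 2 ≤ 2 * (1 + κ⁻¹) * (1 - betaCoef κ x₀ m₁ m₂ l) := by
  have hβ := (betaCoef_mem_Icc hκ0 hκ1 hx h1 h2 hl).2
  have hml := norm_chord_le h1 h2 hl
  have hsq := norm_chord_sq (l := l) h1 h2
  set v := (1 - l) • m₁ + l • m₂ with hv
  set p := curvePt κ x₀ m₁ m₂ l
  set β := betaCoef κ x₀ m₁ m₂ l
  have hpv : v - p = (1 - β) • chordVec κ x₀ m₁ m₂ l := by
    simp only [p, β, v, curvePt, chordVec]; module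
  have hξ : ‖chordVec κ x₀ m₁ m₂ l‖ ≤ 1 + κ⁻¹ := by
    rw [chordVec]
    refine (norm_sub_le _ _).trans (add_le_add hml ?_)
    rw [norm_smul, hx, Real.norm_of_nonneg (inv_nonneg.2 hκ0.le), mul_one]
  have hd : ‖p‖ - ‖v‖ ≤ (1 - β) * (1 + κ⁻¹) := by
    refine (norm_sub_norm_le p v).trans ?_
    rw [norm_sub_rev, hpv, norm_smul, Real.norm_of_nonneg (by linarith)]
    exact mul_le_mul_of_nonneg_left hξ (by linarith)
  rw [hm] at hd
  nlinarith [norm_nonneg v]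

end Curve

end

/-! ### Size of the target, and the scalar form of quasiconvexity -/

section

variable {n : ℕ}

lemma dir_smul {x : Rn n} (hx : ‖x‖ = 1) {r : ℝ} (hr : 0 < r) : dir (r • x) = x := by
  rw [dir, norm_smul, hx, Real.norm_of_nonneg hr.le, mul_one, smul_smul, inv_mul_cancel₀ hr.ne',
    one_smul]

lemma smul_mem_Gam {Ω : Set (Rn n)} {c₁ c₂ r : ℝ} {x : Rn n} (hx : x ∈ Ω) (hr : r ∈ Icc c₁ c₂) :
    r • x ∈ Gam Ω c₁ c₂ := ⟨x, hx, r, hr.1, hr.2, rfl⟩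

section Target

variable {κ c₁ c₂ : ℝ} {Ω S : Set (Rn n)} {E : Rn n → Set (Rn n)} {s : Rn n → Rn n → ℝ}

lemma HypA.direction (hA : HypA κ c₁ c₂ Ω S E s) {X Y : Rn n} (hX : X ∈ Gam Ω c₁ c₂)
    (hY : Y ∈ S) : dir (Y - X) ∈ E X ∧ s X (dir (Y - X)) = ‖Y - X‖ ∧ 0 < ‖Y - X‖ := by
  rw [hA.graph X hX] at hY
  obtain ⟨m, hm, rfl⟩ := hY
  have hs := hA.pos X hX m hm
  have hm1 := norm_eq_one_of_mem_unitSphere (hA.directions X hX hm).1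
  rw [add_sub_cancel_left, dir_smul hm1 hs, norm_smul, hm1, Real.norm_of_nonneg hs.le, mul_one]
  exact ⟨hm, rfl, hs⟩

lemma eq_add_smul_dir {X Y : Rn n} (h : 0 < ‖Y - X‖) : Y = X + ‖Y - X‖ • dir (Y - X) := by
  rw [dir, smul_smul, mul_inv_cancel₀ h.ne', one_smul, add_sub_cancel]

lemma norm_dir {v : Rn n} (h : 0 < ‖v‖) : ‖dir v‖ = 1 := by
  rw [dir, norm_smul, norm_inv, norm_norm, inv_mul_cancel₀ h.ne']

lemma targetCurvePt_mem (hA : HypA κ c₁ c₂ Ω S E s) {X Y₁ Y₂ : Rn n} (hX : X ∈ Gam Ω c₁ c₂)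
    (h1 : Y₁ ∈ S) (h2 : Y₂ ∈ S) {l : ℝ} (hl : l ∈ Icc (0 : ℝ) 1) :
    targetCurvePt κ s X Y₁ Y₂ l ∈ S := by
  rw [hA.graph X hX]
  exact ⟨_, hA.convex X hX _ (hA.direction hX h1).1 _ (hA.direction hX h2).1 l hl, rfl⟩

/-- H.B is used at radius `c₂` on the same ray, with `√(1 + a) - 1 ≤ a / 2`. The bound is twice `c₂
/ κ`, which dominates the shift `|r₀ - r| / κ` appearing later and keeps the denominators there
positive. -/
lemma le_norm_sub_of_hypB (hκ0 : 0 < κ) (hc₁ : 0 < c₁) (hc₂ : c₁ < c₂)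
    (hΩ : Ω ⊆ unitSphere n) (hA : HypA κ c₁ c₂ Ω S E s) (hB : HypB κ c₁ c₂ Ω S) {X Y : Rn n}
    (hX : X ∈ Gam Ω c₁ c₂) (hY : Y ∈ S) : 2 * (c₂ / κ) ≤ ‖Y - X‖ := by
  obtain ⟨x, hx, r, hr1, hr2, rfl⟩ := hX
  have hx1 := norm_eq_one_of_mem_unitSphere (hΩ hx)
  have hX' : c₂ • x ∈ Gam Ω c₁ c₂ := smul_mem_Gam hx ⟨hc₂.le, le_rfl⟩
  have hb := hB _ hX' Y hY
  have hpos := (hA.direction hX' hY).2.2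
  have hc : 0 < c₂ := hc₁.trans hc₂
  rw [norm_smul, hx1, mul_one, Real.norm_of_nonneg hc.le, div_le_iff₀ hpos] at hb
  have hsqrt : √(1 + ((1 + κ) ^ 2)⁻¹) - 1 ≤ ((1 + κ) ^ 2)⁻¹ / 2 := by
    have h0 : 0 < ((1 + κ) ^ 2)⁻¹ := by positivity
    rw [sub_le_iff_le_add, Real.sqrt_le_iff]
    constructor <;> nlinarith
  have h1 : c₂ ≤ κ * (((1 + κ) ^ 2)⁻¹ / 2) * ‖Y - c₂ • x‖ :=
    hb.trans (by gcongr)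
  have h2 : 2 * c₂ * (1 + κ) ^ 2 ≤ κ * ‖Y - c₂ • x‖ := by
    have := mul_le_mul_of_nonneg_right h1 (by positivity : 0 ≤ 2 * (1 + κ) ^ 2)
    field_simp at this
    linarith
  have h3 : ‖Y - c₂ • x‖ ≤ ‖Y - r • x‖ + c₂ := by
    have : Y - c₂ • x = (Y - r • x) + (r - c₂) • x := by module
    rw [this]
    refine (norm_add_le _ _).trans (add_le_add le_rfl ?_)
    rw [norm_smul, hx1, mul_one, Real.norm_eq_abs, abs_le]
    constructor <;> linarith
  rw [← mul_div_assoc, div_le_iff₀ hκ0]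
  have h4 := mul_le_mul_of_nonneg_left h3 hκ0.le
  nlinarith [mul_pos hc hκ0, mul_nonneg hc.le (sq_nonneg κ)]

/-- Seen from one fixed point of `Γ`, the distance to the target is Lipschitz on a set of unit
vectors, so it oscillates by at most `2 * C`. -/
lemma exists_norm_sub_le (hΩ : Ω ⊆ unitSphere n) (hA : HypA κ c₁ c₂ Ω S E s) (hc₁ : 0 < c₁) :
    ∃ R, 0 < R ∧ ∀ X ∈ Gam Ω c₁ c₂, ∀ Y ∈ S, ‖Y - X‖ ≤ R := by
  obtain ⟨C, hC, hLip⟩ := hA.lipschitz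
  by_cases hne : ∃ X₀ ∈ Gam Ω c₁ c₂, ∃ Y₀, Y₀ ∈ S
  · obtain ⟨X₀, hX₀, Y₀, hY₀⟩ := hne
    refine ⟨‖X₀‖ + c₂ + ‖Y₀ - X₀‖ + 2 * C, ?_, fun X hX Y hY => ?_⟩
    · obtain ⟨x, hx, r, hr1, hr2, rfl⟩ := hX₀
      have : 0 < c₂ := by linarith
      positivity
    · obtain ⟨h1, h2, h3⟩ := hA.direction hX₀ hY
      obtain ⟨h1', h2', h3'⟩ := hA.direction hX₀ hY₀
      have hl := (abs_le.1 (hLip X₀ hX₀ _ h1 _ h1')).2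
      have hd : ‖dir (Y - X₀) - dir (Y₀ - X₀)‖ ≤ 2 := by
        refine (norm_sub_le _ _).trans ?_
        rw [norm_dir h3, norm_dir h3']; norm_num
      have hXc : ‖X‖ ≤ c₂ := by
        obtain ⟨x, hx, r, hr1, hr2, rfl⟩ := hX
        rw [norm_smul, norm_eq_one_of_mem_unitSphere (hΩ hx), mul_one, Real.norm_of_nonneg
          (hc₁.le.trans hr1)]
        exact hr2
      have hd' := mul_le_mul_of_nonneg_left hd hC.le
      have : ‖Y - X‖ ≤ ‖Y - X₀‖ + (‖X₀‖ + ‖X‖) := by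
        refine (norm_sub_le_norm_sub_add_norm_sub Y X₀ X).trans ?_
        gcongr
        exact norm_sub_le _ _
      rw [h2, h2'] at hl
      linarith
  · push Not at hne
    exact ⟨1, one_pos, fun X hX Y hY => absurd hY (hne X hX Y)⟩

end Target

/-- The scalar inequality behind the strict quasiconvexity of ovals along target curves. -/
lemma quasiconvex_scalar {κ μ β l i₁ i₂ i r₀ A W d D T q₁ q₂ q e : ℝ}
    (hκ0 : 0 < κ) (hκ1 : κ < 1) (hμ0 : 0 ≤ μ) (hμ1 : μ < κ) (hβ0 : 0 ≤ β) (hβ1 : β ≤ 1)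
    (hl0 : 0 ≤ l) (hl1 : l ≤ 1) (hi₁ : 0 ≤ i₁) (hi₂ : 0 ≤ i₂) (hi : 0 ≤ i) (hr₀ : 0 < r₀)
    (hD : 0 < D) (hiD : i * (2 * D) ≤ 1)
    (hC : (1 - l) * β * (i₁ + μ / r₀) + l * β * (i₂ + μ / r₀) ≤ i + μ / r₀)
    (hA : 2 * A = W ^ 2 - d ^ 2) (hW : 0 ≤ W) (hd : |d| ≤ D) (hT : 0 ≤ T) (hAT : A ≤ κ * r₀ * T)
    (hq₁W : -W + d ≤ q₁) (hq : q = β * ((1 - l) * q₁ + l * q₂) - (1 - β) * T)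
    (hqW : q ≤ W + d) (he : 0 ≤ e) (h1 : -e ≤ A * i₁ - q₁) (h2 : -e ≤ A * i₂ - q₂) :
    (1 - κ ^ 2) / 2 * ((1 - β) * T) - 2 * e ≤ A * i - q := by
  have hl1' : 0 ≤ 1 - l := by linarith
  have hβT : 0 ≤ (1 - β) * T := mul_nonneg (by linarith) hT
  have hκ2 : κ ^ 2 ≤ 1 := by nlinarith
  set M := (1 - l) * β * i₁ + l * β * i₂ with hM
  have hM0 : 0 ≤ M := by positivity
  have hCM : M ≤ i + (1 - β) * (μ / r₀) := by rw [hM]; linarith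
  have hqM : q ≤ A * M + e - (1 - β) * T := by
    have e1 := mul_le_mul_of_nonneg_left h1 (mul_nonneg hl1' hβ0)
    have e2 := mul_le_mul_of_nonneg_left h2 (mul_nonneg hl0 hβ0)
    have e3 : β * e ≤ e := mul_le_of_le_one_left he hβ1
    have : q = (1 - l) * β * q₁ + l * β * q₂ - (1 - β) * T := by rw [hq]; ring
    rw [this, hM]
    linarith
  -- H.C can be multiplied by `A` only if `A ≥ 0`; the error from `μ` is then at most `κ² (1 - β)
  -- T`, against a gain of `(1 - β) T`.
  rcases le_or_gt 0 A with hA0 | hA0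
  · have e1 : A * M ≤ A * (i + (1 - β) * (μ / r₀)) := mul_le_mul_of_nonneg_left hCM hA0
    have e2 : A * (μ / r₀) ≤ κ ^ 2 * T := by
      have h3 : A * (μ / r₀) ≤ κ * r₀ * T * (μ / r₀) :=
        mul_le_mul_of_nonneg_right hAT (by positivity)
      have h4 : κ * r₀ * T * (μ / r₀) = κ * μ * T := by field_simp
      have h5 : κ * μ * T ≤ κ ^ 2 * T := mul_le_mul_of_nonneg_right (by nlinarith) hT
      linarith
    have e3 : (1 - β) * (A * (μ / r₀)) ≤ (1 - β) * (κ ^ 2 * T) :=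
      mul_le_mul_of_nonneg_left e2 (by linarith)
    have e4 : (1 - κ ^ 2) / 2 * ((1 - β) * T) ≤ (1 - κ ^ 2) * ((1 - β) * T) :=
      mul_le_mul_of_nonneg_right (by linarith) hβT
    linarith
  · have e0 : A * M ≤ 0 := mul_nonpos_of_nonpos_of_nonneg hA0.le hM0
    have e4 : (1 - κ ^ 2) / 2 * ((1 - β) * T) ≤ 1 / 2 * ((1 - β) * T) :=
      mul_le_mul_of_nonneg_right (by nlinarith) hβT
    rw [abs_le] at hd
    -- Here `A M ≤ 0`, so `q ≤ e - (1 - β) T`. If `d ≤ 0`, distance of the target gives also `q ≤ W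
    -- + d ≤ 2 A i`, and the two bounds are averaged. If `d > 0`, the inequality at the first
    -- endpoint forces `d - W ≤ e`, so `-A i` is at most `e / 2`.
    rcases le_or_gt d 0 with hd0 | hd0
    · have hWd : W ≤ -d := (sq_le_sq₀ hW (by linarith)).1 (by linarith [neg_sq d])
      have e5 : (W + d) * (2 * D) ≤ 2 * A := by
        have : (W + d) * (2 * D) ≤ (W + d) * (W - d) :=
          mul_le_mul_of_nonpos_left (by linarith) (by linarith)
        linarith
      have e6 : A * 1 ≤ A * (i * (2 * D)) := mul_le_mul_of_nonpos_left hiD hA0.le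
      have e7 : W + d ≤ 2 * (A * i) := by
        have : (W + d) * (2 * D) ≤ (2 * (A * i)) * (2 * D) := by linarith
        exact le_of_mul_le_mul_right this (by linarith)
      linarith
    · have hAi1 : A * i₁ ≤ 0 := mul_nonpos_of_nonpos_of_nonneg hA0.le hi₁
      have hWd : W ≤ d := (sq_le_sq₀ hW hd0.le).1 (by linarith)
      have e5 : d - W ≤ e := by linarith
      have e6 : (d - W) * (d + W) ≤ e * (2 * D) :=
        mul_le_mul e5 (by linarith) (by linarith) he
      have e7 : -A * i ≤ e * D * i := mul_le_mul_of_nonneg_right (by linarith) hi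
      have e8 : e * (i * (2 * D)) ≤ e * 1 := mul_le_mul_of_nonneg_left hiD he
      linarith

end

/-! ### Quantitative gain along the target curves -/

section

variable {n : ℕ}

/-- This is a difference of squares. When the second factor is positive, the sign of the optical
path difference becomes that of an expression affine in `1/|Y - X₀|` and in the direction of `Y -
X₀`: precisely what H.C and the curve interpolate. -/
lemma opticalPath_sub_mul {κ d : ℝ} {X X₀ Y : Rn n} (hd : κ * d = ‖X₀‖ - ‖X‖)
    (hY : 0 < ‖Y - X₀‖) :
    (opticalPath κ X Y - opticalPath κ X₀ Y) * (‖X - Y‖ + ‖Y - X₀‖ + d) =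
      κ * (‖X - X₀‖ ^ 2 - d ^ 2 - 2 * ‖Y - X₀‖ * (inner ℝ (X - X₀) (dir (Y - X₀)) + d)) := by
  have h1 : opticalPath κ X Y - opticalPath κ X₀ Y = κ * (‖X - Y‖ - ‖Y - X₀‖ - d) := by
    rw [opticalPath, opticalPath, norm_sub_rev X₀ Y]; linarith
  have h2 : ‖X - Y‖ ^ 2 = ‖X - X₀‖ ^ 2 -
      2 * (‖Y - X₀‖ * inner ℝ (X - X₀) (dir (Y - X₀))) + ‖Y - X₀‖ ^ 2 := by
    have : X - Y = (X - X₀) - (Y - X₀) := by abel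
    rw [this, norm_sub_sq_real, dir, real_inner_smul_right, mul_inv_cancel_left₀ hY.ne']
  rw [h1]
  linear_combination κ * h2

lemma scaled_lower_bound {δ σ σ₂ k s s₁ P e : ℝ} (h : δ * σ = k * s * P) (hk : 0 < k)
    (hs₁ : 0 < s₁) (hs : s₁ ≤ s) (hσ : 0 < σ) (hσ₂ : σ ≤ σ₂) (he : 0 ≤ e) (hδ : -e ≤ δ) :
    -(σ₂ / (k * s₁) * e) ≤ P := by
  have hs0 : 0 < s := hs₁.trans_le hs
  have h1 : -(e * σ₂) ≤ k * s * P := by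
    rw [← h]
    nlinarith [mul_le_mul_of_nonneg_right hδ hσ.le, mul_le_mul_of_nonneg_left hσ₂ he]
  have h2 : e * σ₂ ≤ k * s * (σ₂ / (k * s₁) * e) := by
    have : k * s * (σ₂ / (k * s₁) * e) = (e * σ₂) * (s / s₁) := by field_simp
    rw [this]
    exact le_mul_of_one_le_right (mul_nonneg he (hσ.le.trans hσ₂)) ((one_le_div hs₁).2 hs)
  have h3 : k * s * -(σ₂ / (k * s₁) * e) ≤ k * s * P := by linarith
  exact le_of_mul_le_mul_left h3 (mul_pos hk hs0)

lemma scaled_gain {δ σ σ₁ σ₂ k s s₁ s₂ P p q : ℝ} (h : δ * σ = k * s * P) (hk : 0 < k)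
    (hs₁ : 0 < s₁) (hs : s₁ ≤ s) (hs₂ : s ≤ s₂) (hσ₁ : 0 < σ₁) (hσ : σ₁ ≤ σ) (hσ₂ : σ ≤ σ₂)
    (hp : 0 ≤ p) (hq : 0 ≤ q) (hP : p - q ≤ P) :
    k * s₁ / σ₂ * p - k * s₂ / σ₁ * q ≤ δ := by
  have hσ0 : 0 < σ := hσ₁.trans_le hσ
  have hs0 : 0 < s := hs₁.trans_le hs
  have hs20 : 0 < s₂ := hs0.trans_le hs₂
  have hδ : δ = k * s / σ * P := by field_simp; linarith
  have h1 : k * s₁ / σ₂ ≤ k * s / σ := by gcongr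
  have h2 : k * s / σ ≤ k * s₂ / σ₁ := by gcongr
  have h3 := mul_le_mul_of_nonneg_left hP (by positivity : 0 ≤ k * s / σ)
  have h4 := mul_le_mul_of_nonneg_right h1 hp
  have h5 := mul_le_mul_of_nonneg_right h2 hq
  rw [hδ]; linarith

/-- In polar coordinates about `X` the radius is bounded and Lipschitz in the direction. The same
estimate later excludes rays tangent to the target. -/
lemma exists_norm_sub_le_mul_dir_sub {κ c₁ c₂ : ℝ} {Ω S : Set (Rn n)} {E : Rn n → Set (Rn n)}
    {s : Rn n → Rn n → ℝ} (hΩ : Ω ⊆ unitSphere n) (hA : HypA κ c₁ c₂ Ω S E s) (hc₁ : 0 < c₁) :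
    ∃ K, 0 < K ∧ ∀ X ∈ Gam Ω c₁ c₂, ∀ Y₁ ∈ S, ∀ Y₂ ∈ S,
      ‖Y₁ - Y₂‖ ≤ K * ‖dir (Y₁ - X) - dir (Y₂ - X)‖ := by
  obtain ⟨R, hR0, hR⟩ := exists_norm_sub_le hΩ hA hc₁
  obtain ⟨K, hK0, hK⟩ := hA.lipschitz
  refine ⟨K + R, by positivity, fun X hX Y₁ hY₁ Y₂ hY₂ => ?_⟩
  obtain ⟨hm₁, hs₁, hp₁⟩ := hA.direction hX hY₁
  obtain ⟨hm₂, hs₂, hp₂⟩ := hA.direction hX hY₂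
  have hL := hK _ hX _ hm₁ _ hm₂
  rw [hs₁, hs₂] at hL
  have : Y₁ - Y₂ = (‖Y₁ - X‖ - ‖Y₂ - X‖) • dir (Y₁ - X) +
      ‖Y₂ - X‖ • (dir (Y₁ - X) - dir (Y₂ - X)) := by
    have e1 := eq_add_smul_dir hp₁
    have e2 := eq_add_smul_dir hp₂
    rw [smul_sub, sub_smul]
    nth_rewrite 1 [e1]; nth_rewrite 1 [e2]
    abel
  rw [this]
  refine (norm_add_le _ _).trans ?_
  rw [norm_smul, norm_smul, norm_dir hp₁, mul_one, norm_norm, add_mul, Real.norm_eq_abs]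
  exact add_le_add hL (mul_le_mul_of_nonneg_right (hR _ hX _ hY₂) (norm_nonneg _))

set_option maxHeartbeats 1000000 in
/-- Strict quasiconvexity of the optical path length along the target curves, in a form that is
stable under perturbations of size `e`. -/
theorem exists_opticalPath_gain {κ c₁ c₂ : ℝ} (hκ0 : 0 < κ) (hκ1 : κ < 1) (hc₁ : 0 < c₁)
    (hc₂ : c₁ < c₂) {Ω S : Set (Rn n)} {E : Rn n → Set (Rn n)} {s : Rn n → Rn n → ℝ}
    (hΩ : Ω ⊆ unitSphere n) (hA : HypA κ c₁ c₂ Ω S E s) (hB : HypB κ c₁ c₂ Ω S)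
    (hC : HypC κ c₁ c₂ Ω E s) :
    ∃ c C : ℝ, 0 < c ∧ 0 < C ∧ ∀ x₀ ∈ Ω, ∀ r₀ ∈ Icc c₁ c₂, ∀ x ∈ Ω, ∀ r ∈ Icc c₁ c₂,
      ∀ Y₁ ∈ S, ∀ Y₂ ∈ S, ∀ l ∈ Icc (1 / 4 : ℝ) (3 / 4), ∀ e : ℝ, 0 ≤ e →
      opticalPath κ (r₀ • x₀) Y₁ - e ≤ opticalPath κ (r • x) Y₁ →
      opticalPath κ (r₀ • x₀) Y₂ - e ≤ opticalPath κ (r • x) Y₂ →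
      opticalPath κ (r₀ • x₀) (targetCurvePt κ s (r₀ • x₀) Y₁ Y₂ l) +
          c * ‖Y₁ - Y₂‖ ^ 2 * ‖x - x₀‖ ^ 2 - C * e ≤
        opticalPath κ (r • x) (targetCurvePt κ s (r₀ • x₀) Y₁ Y₂ l) := by
  obtain ⟨R, hR0, hR⟩ := exists_norm_sub_le hΩ hA hc₁
  obtain ⟨K, hK0, hYYall⟩ := exists_norm_sub_le_mul_dir_sub hΩ hA hc₁
  obtain ⟨μ, hμ0, hμ1, hC⟩ := hC
  have hc20 : 0 < c₂ := hc₁.trans hc₂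
  have hκ2 : 0 < 1 - κ ^ 2 := by nlinarith
  set D := c₂ / κ with hD
  have hD0 : 0 < D := div_pos hc20 hκ0
  set a := 2 * κ * (2 * D) / (3 * R) with ha
  have ha0 : 0 < a := by positivity
  set b := 2 * κ * R / D with hb
  have hb0 : 0 < b := by positivity
  set C₁ := 3 * R / (2 * κ * (2 * D)) with hC₁
  have hC₁0 : 0 < C₁ := by positivity
  -- The factors come from the scalar inequality, from `T ≥ c₁ / (2κ) |x - x₀|²`, from the chord gap
  -- with `l (1 - l) ≥ 1/8`, and from the Lipschitz constant `K`.
  set t := (1 - κ ^ 2) / 2 * (c₁ / (2 * κ)) * (1 / 8 / (2 * (1 + κ⁻¹))) * (1 / K ^ 2)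
    with ht
  have ht0 : 0 < t := by positivity
  refine ⟨a * t, b * (2 * C₁), by positivity, by positivity, ?_⟩
  intro x₀ hx₀ r₀ hr₀ x hx r hr Y₁ hY₁ Y₂ hY₂ l hl e he h1 h2
  have hx₀1 := norm_eq_one_of_mem_unitSphere (hΩ hx₀)
  have hx1 := norm_eq_one_of_mem_unitSphere (hΩ hx)
  have hr₀0 : 0 < r₀ := hc₁.trans_le hr₀.1
  have hr0 : 0 < r := hc₁.trans_le hr.1
  have hX₀ := smul_mem_Gam hx₀ hr₀
  have hX := smul_mem_Gam hx hr
  have hl' : l ∈ Icc (0 : ℝ) 1 := ⟨by linarith [hl.1], by linarith [hl.2]⟩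
  have hdir : dir (r₀ • x₀) = x₀ := dir_smul hx₀1 hr₀0
  have hnX₀ : ‖r₀ • x₀‖ = r₀ := by rw [norm_smul, hx₀1, mul_one, Real.norm_of_nonneg hr₀0.le]
  have hnX : ‖r • x‖ = r := by rw [norm_smul, hx1, mul_one, Real.norm_of_nonneg hr0.le]
  have hYl := targetCurvePt_mem hA hX₀ hY₁ hY₂ hl'
  obtain ⟨hm₁, hs₁, hp₁⟩ := hA.direction hX₀ hY₁
  obtain ⟨hm₂, hs₂, hp₂⟩ := hA.direction hX₀ hY₂
  obtain ⟨hml, hsl, hpl⟩ := hA.direction hX₀ hYl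
  have hm := hA.convex _ hX₀ _ hm₁ _ hm₂ l hl'
  have hm1 := norm_eq_one_of_mem_unitSphere (hA.directions _ hX₀ hm).1
  have hCl := hC _ hX₀ _ hm₁ _ hm₂ l hl'
  have hm₁1 := norm_dir hp₁
  have hm₂1 := norm_dir hp₂
  have hdl : dir (targetCurvePt κ s (r₀ • x₀) Y₁ Y₂ l - r₀ • x₀) =
      curvePt κ x₀ (dir (Y₁ - r₀ • x₀)) (dir (Y₂ - r₀ • x₀)) l := by
    rw [targetCurvePt, add_sub_cancel_left, dir_smul hm1 (hA.pos _ hX₀ _ hm), hdir]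
  rw [hdir] at hCl hm hm1
  rw [hdl] at hsl
  rw [hsl, hs₁, hs₂, hnX₀] at hCl
  have hβ := betaCoef_mem_Icc hκ0 hκ1 hx₀1 hm₁1 hm₂1 hl'
  have hβm := norm_sub_sq_le_one_sub_betaCoef hκ0 hκ1 hx₀1 hm₁1 hm₂1 hl' hm1
  have hcurve := curvePt_eq (κ := κ) (x₀ := x₀) (m₁ := dir (Y₁ - r₀ • x₀))
    (m₂ := dir (Y₂ - r₀ • x₀)) (l := l)
  have hYY : ‖Y₁ - Y₂‖ ≤ K * ‖dir (Y₁ - r₀ • x₀) - dir (Y₂ - r₀ • x₀)‖ :=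
    hYYall _ hX₀ _ hY₁ _ hY₂
  set Yl := targetCurvePt κ s (r₀ • x₀) Y₁ Y₂ l
  set m₁ := dir (Y₁ - r₀ • x₀)
  set m₂ := dir (Y₂ - r₀ • x₀)
  set β := betaCoef κ x₀ m₁ m₂ l
  set d := (r₀ - r) / κ with hd
  set w := r • x - r₀ • x₀ with hw
  set A := (‖w‖ ^ 2 - d ^ 2) / 2 with hAdef
  -- Minus the value at `x₀/κ` of the affine form `v ↦ ⟨w, v⟩ + d`, as `hwx` records.
  set T := r * ‖x - x₀‖ ^ 2 / (2 * κ) with hT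
  have hT0 : 0 ≤ T := by positivity
  have hκd : κ * d = ‖r₀ • x₀‖ - ‖r • x‖ := by rw [hnX₀, hnX, hd]; field_simp
  have hκd' : κ * d = r₀ - r := by rw [hd]; field_simp
  have hdD : |d| ≤ D := by
    rw [hd, hD, abs_div, abs_of_pos hκ0]
    gcongr
    rw [abs_le]; constructor <;> linarith [hr.1, hr.2, hr₀.1, hr₀.2]
  have hxx : ‖x - x₀‖ ^ 2 = 2 - 2 * inner ℝ x x₀ := by
    rw [norm_sub_sq_real, hx1, hx₀1]; ring
  have hw2 : ‖w‖ ^ 2 = (r - r₀) ^ 2 + r * r₀ * ‖x - x₀‖ ^ 2 := by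
    rw [hw, norm_sub_sq_real, hnX, hnX₀, real_inner_smul_left, real_inner_smul_right, hxx]; ring
  have hAT : A ≤ κ * r₀ * T := by
    have : κ * r₀ * T = r * r₀ * ‖x - x₀‖ ^ 2 / 2 := by rw [hT]; field_simp
    rw [this, hAdef, hw2]
    have h3 : (r - r₀) ^ 2 ≤ d ^ 2 := by
      have : (r - r₀) ^ 2 = κ ^ 2 * d ^ 2 := by rw [← mul_pow, hκd']; ring
      rw [this]
      exact mul_le_of_le_one_left (sq_nonneg d) (by linarith)
    linarith
  have hbounds : ∀ Y ∈ S, 2 * D ≤ ‖Y - r₀ • x₀‖ ∧ ‖Y - r₀ • x₀‖ ≤ R ∧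
      D ≤ ‖r • x - Y‖ + ‖Y - r₀ • x₀‖ + d ∧ ‖r • x - Y‖ + ‖Y - r₀ • x₀‖ + d ≤ 3 * R := by
    intro Y hY
    have e1 := le_norm_sub_of_hypB hκ0 hc₁ hc₂ hΩ hA hB hX₀ hY
    have e2 := hR _ hX₀ _ hY
    have e3 := hR _ hX _ hY
    rw [norm_sub_rev] at e3
    have e4 := abs_le.1 hdD
    refine ⟨e1, e2, ?_, ?_⟩ <;> linarith [norm_nonneg (r • x - Y)]
  have hident : ∀ Y ∈ S, (opticalPath κ (r • x) Y - opticalPath κ (r₀ • x₀) Y) *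
      (‖r • x - Y‖ + ‖Y - r₀ • x₀‖ + d) = 2 * κ * ‖Y - r₀ • x₀‖ *
        (A * (1 / ‖Y - r₀ • x₀‖) - (inner ℝ w (dir (Y - r₀ • x₀)) + d)) := by
    intro Y hY
    have hp := (hA.direction hX₀ hY).2.2
    rw [opticalPath_sub_mul hκd hp, hAdef, ← hw]
    field_simp
  have hlow : ∀ Y ∈ S, opticalPath κ (r₀ • x₀) Y - e ≤ opticalPath κ (r • x) Y →
      -(C₁ * e) ≤ A * (1 / ‖Y - r₀ • x₀‖) - (inner ℝ w (dir (Y - r₀ • x₀)) + d) := by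
    intro Y hY h
    obtain ⟨b1, b2, b3, b4⟩ := hbounds Y hY
    exact scaled_lower_bound (hident Y hY) (by positivity) (by positivity) b1 (by linarith) b4 he
      (by linarith)
  have hwx : κ⁻¹ * inner ℝ w x₀ + d = -T := by
    rw [hw, inner_sub_left, real_inner_smul_left, real_inner_smul_left,
      real_inner_self_eq_norm_sq, hx₀1, hT, hxx, hd]
    field_simp; ring
  have hinner : ∀ v : Rn n, ‖v‖ = 1 → |inner ℝ w v| ≤ ‖w‖ := fun v hv => by
    simpa [hv] using abs_real_inner_le_norm w v
  obtain ⟨bl1, bl2, bl3, bl4⟩ := hbounds Yl hYl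
  have hmain := quasiconvex_scalar (κ := κ) (μ := μ) (β := β) (l := l) (i₁ := 1 / ‖Y₁ - r₀ • x₀‖)
    (i₂ := 1 / ‖Y₂ - r₀ • x₀‖) (i := 1 / ‖Yl - r₀ • x₀‖) (r₀ := r₀) (A := A) (W := ‖w‖) (d := d)
    (D := D) (T := T) (q₁ := inner ℝ w m₁ + d) (q₂ := inner ℝ w m₂ + d)
    (q := inner ℝ w (curvePt κ x₀ m₁ m₂ l) + d) (e := C₁ * e) hκ0 hκ1 hμ0 hμ1 hβ.1 hβ.2
    hl'.1 hl'.2 (by positivity) (by positivity) (by positivity) hr₀0 hD0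
    (by rw [one_div, inv_mul_le_iff₀ hpl]; linarith) hCl (by rw [hAdef]; ring)
    (norm_nonneg _) hdD hT0 hAT (by linarith [(abs_le.1 (hinner m₁ hm₁1)).1])
    (by
      rw [hcurve, inner_add_right, inner_add_right, real_inner_smul_right, real_inner_smul_right,
        real_inner_smul_right]
      linear_combination (1 - β) * hwx)
    (by linarith [(abs_le.1 (hinner _ hm1)).2]) (by positivity)
    (hlow Y₁ hY₁ h1) (hlow Y₂ hY₂ h2)
  have hgain : t * ‖Y₁ - Y₂‖ ^ 2 * ‖x - x₀‖ ^ 2 ≤ (1 - κ ^ 2) / 2 * ((1 - β) * T) := by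
    have e1 : ‖Y₁ - Y₂‖ ^ 2 ≤ K ^ 2 * ‖m₁ - m₂‖ ^ 2 := by
      rw [← mul_pow]; gcongr
    have e2 : 1 / 8 * ‖m₁ - m₂‖ ^ 2 ≤ 2 * (1 + κ⁻¹) * (1 - β) := by
      have h8 : 1 / 8 ≤ l * (1 - l) := by
        have := mul_nonneg (sub_nonneg.2 hl.1) (sub_nonneg.2 hl.2)
        linarith
      exact (mul_le_mul_of_nonneg_right h8 (sq_nonneg ‖m₁ - m₂‖)).trans hβm
    have e3 : 1 / 8 / (2 * (1 + κ⁻¹)) * (1 / K ^ 2) * ‖Y₁ - Y₂‖ ^ 2 ≤ 1 - β := by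
      calc 1 / 8 / (2 * (1 + κ⁻¹)) * (1 / K ^ 2) * ‖Y₁ - Y₂‖ ^ 2
          ≤ 1 / 8 / (2 * (1 + κ⁻¹)) * (1 / K ^ 2) * (K ^ 2 * ‖m₁ - m₂‖ ^ 2) := by
            gcongr
        _ = (1 / 8 * ‖m₁ - m₂‖ ^ 2) / (2 * (1 + κ⁻¹)) := by field_simp
        _ ≤ 1 - β := by
            rw [div_le_iff₀ (by positivity)]; linarith
    have e4 : c₁ / (2 * κ) * ‖x - x₀‖ ^ 2 ≤ T := by
      rw [hT, div_mul_eq_mul_div]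
      have := hr.1
      gcongr
    calc t * ‖Y₁ - Y₂‖ ^ 2 * ‖x - x₀‖ ^ 2 = (1 - κ ^ 2) / 2 *
          ((1 / 8 / (2 * (1 + κ⁻¹)) * (1 / K ^ 2) * ‖Y₁ - Y₂‖ ^ 2) *
            (c₁ / (2 * κ) * ‖x - x₀‖ ^ 2)) := by rw [ht]; ring
      _ ≤ (1 - κ ^ 2) / 2 * ((1 - β) * T) := by
          gcongr
          linarith [hβ.2]
  have hidl := hident Yl hYl
  rw [hdl] at hidl
  have hfin := scaled_gain hidl (by positivity) (by positivity) bl1 bl2 hD0 bl3 bl4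
    (p := t * ‖Y₁ - Y₂‖ ^ 2 * ‖x - x₀‖ ^ 2) (q := 2 * (C₁ * e)) (by positivity) (by positivity)
    (by linarith)
  rw [ha, hb]
  linarith

end

/-! ### Density points, charts of the sphere and the measure of caps -/

section

variable {n : ℕ}

open Filter Topology in
/-- Almost every point of a set is a limit of points of the set along every direction. -/
lemma ae_exists_seq_direction {E : Type*} [NormedAddCommGroup E] [NormedSpace ℝ E]
    [FiniteDimensional ℝ E] [MeasurableSpace E] [BorelSpace E] (μ : Measure E)
    [μ.IsAddHaarMeasure] (s : Set E) :
    ∀ᵐ p ∂μ, p ∈ s → ∀ v : E, ∃ (d : ℕ → E) (c : ℕ → ℝ), Tendsto d atTop (𝓝 0) ∧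
      (∀ k, 0 < c k) ∧ (∀ k, p + d k ∈ s) ∧ Tendsto (fun k => c k • d k) atTop (𝓝 v) := by
  refine ae_imp_of_ae_restrict ?_
  filter_upwards [Besicovitch.ae_tendsto_measure_inter_div μ s] with p hp v
  -- At a density point all sufficiently small rescalings of a ball about `v` meet the set; the
  -- balls shrink to `v`. The density theorem holds for sets that are not measurable.
  have key : ∀ k : ℕ, ∃ t : ℝ, ∃ a ∈ Metric.closedBall v (1 / ((k : ℝ) + 1)), 0 < t ∧
      t < 1 / ((k : ℝ) + 1) ∧ p + t • a ∈ s := by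
    intro k
    have hk : (0 : ℝ) < 1 / ((k : ℝ) + 1) := by positivity
    have h1 := Measure.eventually_nonempty_inter_smul_of_density_one μ s p hp
      (Metric.closedBall v (1 / ((k : ℝ) + 1))) measurableSet_closedBall
      (Metric.measure_closedBall_pos μ v hk).ne'
    obtain ⟨t, ⟨y, hy, hyt⟩, ht⟩ := (h1.and (Ioo_mem_nhdsGT hk)).exists
    simp only [singleton_add, mem_image, mem_smul_set] at hyt
    obtain ⟨_, ⟨a, ha, rfl⟩, rfl⟩ := hyt
    exact ⟨t, a, ha, ht.1, ht.2, hy⟩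
  choose t a ha ht0 ht1 hs using key
  have hlim : Tendsto (fun k : ℕ => 1 / ((k : ℝ) + 1)) atTop (𝓝 0) :=
    tendsto_one_div_add_atTop_nhds_zero_nat
  have ht : Tendsto t atTop (𝓝 0) :=
    squeeze_zero (fun k => (ht0 k).le) (fun k => (ht1 k).le) hlim
  have hav : Tendsto a atTop (𝓝 v) := by
    rw [tendsto_iff_dist_tendsto_zero]
    exact squeeze_zero (fun k => dist_nonneg) (fun k => ha k) hlim
  refine ⟨fun k => t k • a k, fun k => (t k)⁻¹, ?_, fun k => inv_pos.2 (ht0 k), hs, ?_⟩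
  · simpa using ht.smul hav
  · refine hav.congr fun k => ?_
    rw [smul_smul, inv_mul_cancel₀ (ht0 k).ne', one_smul]

/-- The inverse of `f` on `A` is `K`-Lipschitz, and for the sup norm on `ℝ^(n-1)` the Hausdorff
measure is Lebesgue measure. -/
lemma hausdorff_le_mul_volume_image (hn : 1 ≤ n) {f : Rn n → Fin (n - 1) → ℝ} {A : Set (Rn n)}
    {K : ℝ} (hf : ∀ x ∈ A, ∀ y ∈ A, ‖x - y‖ ≤ K * ‖f x - f y‖) :
    hausdorff n A ≤ ENNReal.ofReal K ^ ((n : ℝ) - 1) * volume (f '' A) := by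
  classical
  rcases A.eq_empty_or_nonempty with rfl | ⟨x₀, -⟩
  · simp
  have : Nonempty (Rn n) := ⟨x₀⟩
  have hinj : InjOn f A := by
    intro x hx y hy hxy
    have := hf x hx y hy
    rw [hxy, sub_self, norm_zero, mul_zero] at this
    exact sub_eq_zero.1 (norm_le_zero_iff.1 this)
  have hleft : ∀ x ∈ A, Function.invFunOn f A (f x) = x := hinj.leftInvOn_invFunOn
  have hL : LipschitzOnWith K.toNNReal (Function.invFunOn f A) (f '' A) := by
    refine LipschitzOnWith.of_dist_le_mul ?_
    rintro _ ⟨x, hx, rfl⟩ _ ⟨y, hy, rfl⟩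
    rw [hleft x hx, hleft y hy, dist_eq_norm, dist_eq_norm]
    exact (hf x hx y hy).trans
      (mul_le_mul_of_nonneg_right (Real.le_coe_toNNReal K) (norm_nonneg _))
  have himg : Function.invFunOn f A '' (f '' A) = A := by
    rw [image_image]
    exact (image_congr hleft).trans (image_id' A)
  have hcast : (n : ℝ) - 1 = ((n - 1 : ℕ) : ℝ) := by push_cast [hn]; ring
  have h := hL.hausdorffMeasure_image_le (d := (n : ℝ) - 1)
    (sub_nonneg.2 (by exact_mod_cast hn))
  rw [himg] at h
  have hvol : (μH[(n : ℝ) - 1] : Measure (Fin (n - 1) → ℝ)) = volume := by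
    rw [hcast, ← hausdorffMeasure_pi_real, Fintype.card_fin]
  rw [hvol] at h
  exact h

/-- Linear charts of the sphere: on the cap `⟨m, x⟩ ≥ a` the projection along `x` is
bi-Lipschitz. -/
lemma exists_cap_chart (hn : 1 ≤ n) {x : Rn n} (hx : ‖x‖ = 1) :
    ∃ π : Rn n →L[ℝ] (Fin (n - 1) → ℝ), (∀ v, ‖π v‖ ≤ ‖v‖) ∧
      ∀ a : ℝ, 0 < a → a ≤ 1 → ∀ m m' : Rn n, ‖m‖ = 1 → ‖m'‖ = 1 → a ≤ inner ℝ m x →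
        a ≤ inner ℝ m' x → ‖m - m'‖ ≤ 2 * n / a * ‖π m - π m'‖ := by
  obtain ⟨k, rfl⟩ : ∃ k, n = k + 1 := ⟨n - 1, by omega⟩
  have : Fact (Module.finrank ℝ (Rn (k + 1)) = k + 1) := ⟨by simp⟩
  have hx0 : x ≠ 0 := by rintro rfl; simp at hx
  let b := OrthonormalBasis.fromOrthogonalSpanSingleton (𝕜 := ℝ) k hx0
  have hb1 : ∀ i, ‖(b i : Rn (k + 1))‖ = 1 := b.norm_eq_one
  have hbx : ∀ i, inner ℝ (b i : Rn (k + 1)) x = 0 := fun i =>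
    Submodule.inner_left_of_mem_orthogonal (Submodule.mem_span_singleton_self x) (b i).2
  refine ⟨ContinuousLinearMap.pi fun i => innerSL ℝ (b i : Rn (k + 1)), ?_, ?_⟩
  · intro v
    refine (pi_norm_le_iff_of_nonneg (norm_nonneg _)).2 fun i => ?_
    have := norm_inner_le_norm (𝕜 := ℝ) (b i : Rn (k + 1)) v
    rw [hb1, one_mul] at this
    simpa using this
  · intro a ha0 ha1 m m' hm hm' hma hma'
    set π : Rn (k + 1) →L[ℝ] (Fin k → ℝ) :=
      ContinuousLinearMap.pi fun i => innerSL ℝ (b i : Rn (k + 1)) with hπ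
    have hperp : ∀ v : Rn (k + 1), ‖v - (inner ℝ v x : ℝ) • x‖ ≤ k * ‖π v‖ := by
      intro v
      have hmem : v - (inner ℝ v x : ℝ) • x ∈ (ℝ ∙ x)ᗮ := by
        rw [Submodule.mem_orthogonal_singleton_iff_inner_right, inner_sub_right,
          real_inner_smul_right, real_inner_self_eq_norm_sq, hx, real_inner_comm]
        ring
      have hs := congrArg (Subtype.val) (b.sum_repr' ⟨_, hmem⟩)
      simp only [Submodule.coe_inner, Submodule.coe_sum, Submodule.coe_smul] at hs
      rw [← hs]
      refine (norm_sum_le _ _).trans ?_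
      refine (Finset.sum_le_card_nsmul _ _ ‖π v‖ fun i _ => ?_).trans (by simp)
      rw [norm_smul, hb1, mul_one, inner_sub_right, real_inner_smul_right, hbx, mul_zero, sub_zero]
      exact norm_le_pi_norm (π v) i
    have hsq : ∀ v : Rn (k + 1), ‖v‖ ^ 2 =
        ‖v - (inner ℝ v x : ℝ) • x‖ ^ 2 + (inner ℝ v x : ℝ) ^ 2 := by
      intro v
      rw [norm_sub_sq_real, norm_smul, real_inner_smul_right, hx, Real.norm_eq_abs, mul_one, sq_abs]
      ring
    have hsum : ‖m - m'‖ ≤ ‖(m - m') - (inner ℝ (m - m') x : ℝ) • x‖ + |inner ℝ (m - m') x| := by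
      have h := norm_add_le ((m - m') - (inner ℝ (m - m') x : ℝ) • x)
        ((inner ℝ (m - m') x : ℝ) • x)
      rw [sub_add_cancel, norm_smul, hx, mul_one, Real.norm_eq_abs] at h
      exact h
    have hp := hperp (m - m')
    set w := (m - m') - (inner ℝ (m - m') x : ℝ) • x with hw
    -- Both points have norm one, so `t² - t'² = ‖p'‖² - ‖p‖²`; dividing by `t + t' ≥ 2 a` bounds
    -- the normal part by the tangential part.
    have hmm : |inner ℝ (m - m') x| * a ≤ ‖w‖ := by
      have e1 := hsq m
      have e2 := hsq m'
      rw [hm] at e1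
      rw [hm'] at e2
      set p := m - (inner ℝ m x : ℝ) • x
      set p' := m' - (inner ℝ m' x : ℝ) • x
      have hwp : w = p - p' := by rw [hw, inner_sub_left]; simp only [p, p']; module
      rw [inner_sub_left]
      set t : ℝ := inner ℝ m x
      set t' : ℝ := inner ℝ m' x
      have hp1 : ‖p‖ ≤ 1 := by nlinarith [norm_nonneg p]
      have hp1' : ‖p'‖ ≤ 1 := by nlinarith [norm_nonneg p']
      have e3 : |t - t'| * (t + t') = |‖p‖ - ‖p'‖| * (‖p‖ + ‖p'‖) := by
        have h := congrArg abs
          (by linarith : (t - t') * (t + t') = -((‖p‖ - ‖p'‖) * (‖p‖ + ‖p'‖)))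
        rwa [abs_neg, abs_mul, abs_mul, abs_of_nonneg (by linarith : 0 ≤ t + t'),
          abs_of_nonneg (by positivity : 0 ≤ ‖p‖ + ‖p'‖)] at h
      have e4 : |‖p‖ - ‖p'‖| ≤ ‖w‖ := by rw [hwp]; exact abs_norm_sub_norm_le p p'
      have e5 : |t - t'| * (2 * a) ≤ |t - t'| * (t + t') :=
        mul_le_mul_of_nonneg_left (by linarith) (abs_nonneg _)
      have e6 : |‖p‖ - ‖p'‖| * (‖p‖ + ‖p'‖) ≤ ‖w‖ * 2 :=
        mul_le_mul e4 (by linarith) (by positivity) (norm_nonneg _)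
      linarith
    rw [map_sub] at hp
    rw [div_mul_eq_mul_div, le_div_iff₀ ha0]
    have e1 : ‖m - m'‖ * a ≤ ‖w‖ * a + |inner ℝ (m - m') x| * a := by
      rw [← add_mul]; exact mul_le_mul_of_nonneg_right hsum ha0.le
    have e2 : ‖w‖ * a ≤ ‖w‖ := mul_le_of_le_one_right (norm_nonneg _) ha1
    have e3 : ‖m - m'‖ * a ≤ 2 * ((k : ℝ) + 1) * ‖π m - π m'‖ := by
      linarith [norm_nonneg (π m - π m')]
    push_cast
    exact e3

lemma isCompact_unitSphere : IsCompact (unitSphere n) := isCompact_sphere 0 1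

/-- The projection is along a point of the cap, because `c` need not lie on the sphere. All of the
cap is within `2σ` of that point, and `16 n` is the chart constant `4 n` times the factor `4` from a
cube of side `4σ`. -/
lemma hausdorff_small_cap_le (hn : 1 ≤ n) (c : Rn n) {σ : ℝ} (hσ : 0 < σ) (hσ1 : σ ≤ 1 / 4) :
    hausdorff n (Metric.ball c σ ∩ unitSphere n) ≤
      ENNReal.ofReal ((16 * n) ^ (n - 1) * σ ^ (n - 1)) := by
  rcases (Metric.ball c σ ∩ unitSphere n).eq_empty_or_nonempty with h | ⟨x₀, hx₀, hx₀1⟩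
  · rw [h]; simp
  have hx1 := norm_eq_one_of_mem_unitSphere hx₀1
  obtain ⟨π, hπ1, hπ2⟩ := exists_cap_chart hn hx1
  have hdist : ∀ m ∈ Metric.ball c σ ∩ unitSphere n, ‖m - x₀‖ ≤ 2 * σ := by
    intro m hm
    have h1 := Metric.mem_ball.1 hm.1
    have h2 := Metric.mem_ball'.1 hx₀
    have := dist_triangle m c x₀
    rw [dist_eq_norm m x₀] at this
    linarith
  have hcap : ∀ m ∈ Metric.ball c σ ∩ unitSphere n, 1 / 2 ≤ inner ℝ m x₀ := by
    intro m hm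
    have h1 := hdist m hm
    have h2 := norm_sub_sq_real m x₀
    rw [norm_eq_one_of_mem_unitSphere hm.2, hx1] at h2
    nlinarith [norm_nonneg (m - x₀)]
  have h := hausdorff_le_mul_volume_image hn (f := π) (A := Metric.ball c σ ∩ unitSphere n)
    (K := 2 * n / (1 / 2)) (fun m hm m' hm' => hπ2 (1 / 2) (by norm_num) (by norm_num) m m'
      (norm_eq_one_of_mem_unitSphere hm.2) (norm_eq_one_of_mem_unitSphere hm'.2)
      (hcap m hm) (hcap m' hm'))
  have hsub : π '' (Metric.ball c σ ∩ unitSphere n) ⊆ Metric.closedBall (π x₀) (2 * σ) := by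
    rintro _ ⟨m, hm, rfl⟩
    rw [Metric.mem_closedBall, dist_eq_norm, ← map_sub]
    exact (hπ1 _).trans (hdist m hm)
  refine h.trans ((mul_le_mul_right (measure_mono hsub) _).trans ?_)
  have hcast : (n : ℝ) - 1 = ((n - 1 : ℕ) : ℝ) := by push_cast [hn]; ring
  rw [Real.volume_pi_closedBall _ (by positivity), Fintype.card_fin, hcast, ENNReal.rpow_natCast,
    ← ENNReal.ofReal_pow (by positivity), ← ENNReal.ofReal_mul (by positivity)]
  refine ENNReal.ofReal_le_ofReal (le_of_eq ?_)
  rw [← mul_pow, ← mul_pow]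
  congr 1; ring

lemma exists_hausdorff_cap_le (hn : 1 ≤ n) :
    ∃ C : ℝ, 0 ≤ C ∧ ∀ (c : Rn n) (σ : ℝ), 0 < σ →
      hausdorff n (Metric.ball c σ ∩ unitSphere n) ≤ ENNReal.ofReal (C * σ ^ (n - 1)) := by
  have hfin : hausdorff n (unitSphere n) < ∞ := by
    refine isCompact_unitSphere.measure_lt_top_of_nhdsWithin fun x _ => ?_
    refine ⟨Metric.ball x (1 / 4) ∩ unitSphere n, ?_, ?_⟩
    · rw [inter_comm]
      exact inter_mem_nhdsWithin _ (Metric.ball_mem_nhds x (by norm_num))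
    · exact (hausdorff_small_cap_le hn x (by norm_num) le_rfl).trans_lt ENNReal.ofReal_lt_top
  set M := (hausdorff n (unitSphere n)).toReal with hM
  have hM0 : 0 ≤ M := ENNReal.toReal_nonneg
  refine ⟨(16 * n) ^ (n - 1) + M * 4 ^ (n - 1), by positivity, fun c σ hσ => ?_⟩
  rcases le_or_gt σ (1 / 4) with hs | hs
  · refine (hausdorff_small_cap_le hn c hσ hs).trans (ENNReal.ofReal_le_ofReal ?_)
    rw [add_mul]
    exact le_add_of_nonneg_right (by positivity)
  · refine (measure_mono inter_subset_right).trans ?_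
    rw [← ENNReal.ofReal_toReal hfin.ne, ← hM]
    refine ENNReal.ofReal_le_ofReal ?_
    have h1 : 1 ≤ (4 * σ) ^ (n - 1) := one_le_pow₀ (by linarith)
    have h2 : M ≤ M * 4 ^ (n - 1) * σ ^ (n - 1) := by
      rw [mul_assoc, ← mul_pow]; exact le_mul_of_one_le_right hM0 h1
    rw [add_mul]
    exact h2.trans (le_add_of_nonneg_left (by positivity))

end

/-! ### Derivatives of the optical path, and points on a common ray -/

section

variable {n : ℕ}

lemma hasFDerivAt_norm_dir {v : Rn n} (hv : 0 < ‖v‖) :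
    HasFDerivAt (fun w : Rn n => ‖w‖) (innerSL ℝ (dir v)) v := by
  have h := (hasStrictFDerivAt_norm_sq v).hasFDerivAt.sqrt (by positivity)
  simp only [Real.sqrt_sq (norm_nonneg _)] at h
  refine h.congr_fderiv ?_
  ext w
  simp only [smul_apply, innerSL_apply_apply, dir, real_inner_smul_left,
    smul_eq_mul, nsmul_eq_mul]
  field_simp
  norm_num

lemma hasFDerivAt_dir {v : Rn n} (hv : 0 < ‖v‖) :
    HasFDerivAt (dir : Rn n → Rn n)
      (‖v‖⁻¹ • (ContinuousLinearMap.id ℝ (Rn n) - (innerSL ℝ (dir v)).smulRight (dir v))) v := by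
  have h := ((hasDerivAt_inv hv.ne').comp_hasFDerivAt v (hasFDerivAt_norm_dir hv)).smul
    (hasFDerivAt_id v)
  refine h.congr_fderiv ?_
  refine ContinuousLinearMap.ext fun w => ?_
  simp only [smul_apply, sub_apply,
    ContinuousLinearMap.id_apply, ContinuousLinearMap.smulRight_apply, innerSL_apply_apply,
    add_apply, Function.comp_apply, id_eq, dir, real_inner_smul_left,
    smul_eq_mul]
  match_scalars <;> field_simp

lemma norm_dir_sub_le {a b : Rn n} (ha : 0 < ‖a‖) (hb : 0 < ‖b‖) :
    ‖dir a - dir b‖ ≤ 2 / ‖a‖ * ‖a - b‖ := by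
  have h : dir a - dir b = ‖a‖⁻¹ • ((a - b) + (‖b‖ - ‖a‖) • dir b) := by
    simp only [dir]
    match_scalars <;> field_simp
    ring
  rw [h, norm_smul, norm_inv, norm_norm, div_eq_inv_mul, mul_assoc]
  refine mul_le_mul_of_nonneg_left ((norm_add_le _ _).trans ?_) (by positivity)
  rw [norm_smul, norm_dir hb, mul_one, Real.norm_eq_abs, two_mul]
  gcongr
  rw [norm_sub_rev]
  exact abs_norm_sub_norm_le b a

lemma hasFDerivAt_opticalPath {κ : ℝ} {X Y : Rn n} (h : 0 < ‖Y - X‖) :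
    HasFDerivAt (fun Z => opticalPath κ X Z) (κ • innerSL ℝ (dir (Y - X))) Y := by
  have h1 : HasFDerivAt (fun Z : Rn n => ‖Z - X‖) (innerSL ℝ (dir (Y - X))) Y := by
    have := (hasFDerivAt_norm_dir h).comp Y ((hasFDerivAt_id Y).sub_const X)
    exact this
  have h2 := (h1.const_mul κ).const_add ‖X‖
  simp only [norm_sub_rev _ X] at h2
  exact h2

/-- Two points on a ray into `Y` with the same optical path length coincide, if the one farther
from `Y` satisfies the refraction condition. -/
lemma eq_of_same_ray {κ : ℝ} (hκ0 : 0 < κ) (hκ1 : κ < 1) {X₁ X₂ Y : Rn n}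
    (h1 : 0 < ‖Y - X₁‖) (h2 : 0 < ‖Y - X₂‖) (hX₁ : 0 < ‖X₁‖) (hX₂ : 0 < ‖X₂‖)
    (hr1 : κ ≤ inner ℝ (dir X₁) (dir (Y - X₁))) (hr2 : κ ≤ inner ℝ (dir X₂) (dir (Y - X₂)))
    (he : dir (Y - X₁) = dir (Y - X₂)) (hG : opticalPath κ X₁ Y = opticalPath κ X₂ Y) :
    X₁ = X₂ := by
  wlog hle : ‖Y - X₁‖ ≤ ‖Y - X₂‖ generalizing X₁ X₂
  · exact (this h2 h1 hX₂ hX₁ hr2 hr1 he.symm hG.symm (le_of_not_ge hle)).symm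
  set t := ‖Y - X₂‖ - ‖Y - X₁‖ with ht
  have hX : X₁ = X₂ + t • dir (Y - X₂) := by
    have e1 := eq_add_smul_dir h1
    have e2 := eq_add_smul_dir h2
    rw [he] at e1
    have e3 : X₁ = Y - ‖Y - X₁‖ • dir (Y - X₂) := eq_sub_of_add_eq e1.symm
    have e4 : X₂ = Y - ‖Y - X₂‖ • dir (Y - X₂) := eq_sub_of_add_eq e2.symm
    rw [ht, sub_smul]
    nth_rewrite 1 [e3]
    nth_rewrite 2 [e4]
    abel
  have hn : ‖X₁‖ = ‖X₂‖ + κ * t := by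
    simp only [opticalPath, norm_sub_rev _ Y] at hG
    rw [ht]; linarith
  have hsq : ‖X₁‖ ^ 2 = ‖X₂‖ ^ 2 + 2 * (t * inner ℝ X₂ (dir (Y - X₂))) + t ^ 2 := by
    rw [hX, norm_add_sq_real, real_inner_smul_right, norm_smul, norm_dir h2, mul_one,
      Real.norm_eq_abs, sq_abs]
  have hin : κ * ‖X₂‖ ≤ inner ℝ X₂ (dir (Y - X₂)) := by
    rw [dir, real_inner_smul_left, ← div_eq_inv_mul, le_div_iff₀ hX₂] at hr2
    exact hr2
  have ht0 : 0 ≤ t := sub_nonneg.2 hle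
  -- Squaring `‖X₁‖ = ‖X₂‖ + κ t` and comparing with `hsq`, the cross term is absorbed by the
  -- refraction condition at `X₂`.
  have hts : t ^ 2 ≤ κ ^ 2 * t ^ 2 := by
    have := mul_le_mul_of_nonneg_left hin ht0
    rw [hn] at hsq
    nlinarith
  have : t = 0 := by
    by_contra h
    have : 0 < t ^ 2 := by positivity
    nlinarith [mul_pos this (by nlinarith : 0 < 1 - κ ^ 2)]
  rw [hX, this, zero_smul, add_zero]

lemma isPreconnected_Gam {Ω : Set (Rn n)} {c₁ c₂ : ℝ} (hΩ : IsPreconnected Ω) :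
    IsPreconnected (Gam Ω c₁ c₂) := by
  have h := (isPreconnected_Icc (a := c₁) (b := c₂)).prod hΩ
  have h2 := h.image (fun p : ℝ × Rn n => p.1 • p.2) (by fun_prop)
  convert h2 using 1
  ext X
  constructor
  · rintro ⟨x, hx, r, h1, h2, rfl⟩
    exact ⟨(r, x), ⟨⟨h1, h2⟩, hx⟩, rfl⟩
  · rintro ⟨⟨r, x⟩, ⟨⟨h1, h2⟩, hx⟩, rfl⟩
    exact ⟨x, hx, r, h1, h2, rfl⟩

/-- The points of the target that support the refractor at two different points. -/
def multiSupport (κ : ℝ) (Ω S : Set (Rn n)) (u : Rn n → ℝ) : Set (Rn n) :=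
  {Y | ∃ x₁ ∈ Ω, ∃ x₂ ∈ Ω, x₁ ≠ x₂ ∧ Y ∈ subdiff κ Ω S u x₁ ∧ Y ∈ subdiff κ Ω S u x₂}

end

/-! ### Points supporting the refractor twice form a null set -/

section

variable {n : ℕ}

section Tangent

open Filter Topology

variable {V : Type*} [NormedAddCommGroup V] [NormedSpace ℝ V] {W : Type*} [NormedAddCommGroup W]
  [NormedSpace ℝ W] {Z : Type*} [NormedAddCommGroup Z] [NormedSpace ℝ Z]

/-- `p` can be approached within `Q` along every direction. -/
def HasAllDirections (Q : Set V) (p : V) : Prop :=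
  ∀ v : V, ∃ (d : ℕ → V) (c : ℕ → ℝ), Tendsto d atTop (𝓝 0) ∧
      (∀ k, 0 < c k) ∧ (∀ k, p + d k ∈ Q) ∧ Tendsto (fun k => c k • d k) atTop (𝓝 v)

lemma HasAllDirections.norm_le {Q : Set V} {p : V} (h : HasAllDirections Q p) {f : V → W}
    {g : V → Z} {f' : V →L[ℝ] W} {g' : V →L[ℝ] Z} (hf : HasFDerivWithinAt f f' Q p)
    (hg : HasFDerivWithinAt g g' Q p) {C : ℝ}
    (hC : ∀ q ∈ Q, ‖f q - f p‖ ≤ C * ‖g q - g p‖) (v : V) : ‖f' v‖ ≤ C * ‖g' v‖ := by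
  obtain ⟨d, c, hd, hc, hQ, hlim⟩ := h v
  have h1 := (hf.lim hd (Eventually.of_forall hQ) hlim).norm
  have h2 := ((hg.lim hd (Eventually.of_forall hQ) hlim).norm).const_mul C
  refine le_of_tendsto_of_tendsto' h1 h2 fun k => ?_
  rw [norm_smul, norm_smul, mul_left_comm]
  exact mul_le_mul_of_nonneg_left (hC _ (hQ k)) (norm_nonneg _)

/-- A first-order condition at a contact point: approach along `v` and along `-v` gives both
inequalities, although `Q` need not be a neighbourhood of `p`. -/
lemma HasAllDirections.fderiv_eq {Q : Set V} {p : V} (h : HasAllDirections Q p) {f g : V → ℝ}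
    {f' g' : V →L[ℝ] ℝ} (hf : HasFDerivWithinAt f f' Q p) (hg : HasFDerivWithinAt g g' Q p)
    (hfg : ∀ q ∈ Q, f q ≤ g q) (hp : f p = g p) (v : V) : f' v = g' v := by
  have key : ∀ v, f' v ≤ g' v := by
    intro v
    obtain ⟨d, c, hd, hc, hQ, hlim⟩ := h v
    refine le_of_tendsto_of_tendsto' (hf.lim hd (Eventually.of_forall hQ) hlim)
      (hg.lim hd (Eventually.of_forall hQ) hlim) fun k => ?_
    rw [hp, smul_eq_mul, smul_eq_mul]
    exact mul_le_mul_of_nonneg_left (by linarith [hfg _ (hQ k)]) (hc k).le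
  refine le_antisymm (key v) ?_
  have := key (-v)
  rw [map_neg, map_neg] at this
  linarith

end Tangent

section Null

variable {κ c₁ c₂ : ℝ} {Ω S : Set (Rn n)} {E : Rn n → Set (Rn n)} {s : Rn n → Rn n → ℝ}

/-- At a point where the target and the dual potential are differentiable, the support is
unique. -/
lemma eq_of_differentiable_support (hn : 1 ≤ n) (hκ0 : 0 < κ) (hκ1 : κ < 1) (hc₁ : 0 < c₁)
    (hΩ : Ω ⊆ unitSphere n) (hΩconn : IsPreconnected Ω) (hA : HypA κ c₁ c₂ Ω S E s)
    {Q : Set (Fin (n - 1) → ℝ)} {p : Fin (n - 1) → ℝ} (hp : p ∈ Q) (hdirs : HasAllDirections Q p)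
    {Φ : (Fin (n - 1) → ℝ) → Rn n} (hΦS : MapsTo Φ Q S)
    {L : (Fin (n - 1) → ℝ) →L[ℝ] Rn n} (hΦ : HasFDerivWithinAt Φ L Q p)
    {f : (Fin (n - 1) → ℝ) → ℝ} {f' : (Fin (n - 1) → ℝ) →L[ℝ] ℝ}
    (hf : HasFDerivWithinAt f f' Q p) {C : ℝ}
    (hC : ∀ q ∈ Q, ‖q - p‖ ≤ C * ‖Φ q - Φ p‖) {X₁ X₂ : Rn n} (hX₁ : X₁ ∈ Gam Ω c₁ c₂)
    (hX₂ : X₂ ∈ Gam Ω c₁ c₂) (h₁ : ∀ q ∈ Q, f q ≤ opticalPath κ X₁ (Φ q))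
    (h₂ : ∀ q ∈ Q, f q ≤ opticalPath κ X₂ (Φ q)) (he₁ : f p = opticalPath κ X₁ (Φ p))
    (he₂ : f p = opticalPath κ X₂ (Φ p)) : X₁ = X₂ := by
  have hY : Φ p ∈ S := hΦS hp
  set Y := Φ p with hYdef
  have hpos : ∀ X ∈ Gam Ω c₁ c₂, 0 < ‖Y - X‖ := fun X hX => (hA.direction hX hY).2.2
  have hnormX : ∀ X ∈ Gam Ω c₁ c₂, 0 < ‖X‖ := by
    rintro _ ⟨x, hx, r, hr1, -, rfl⟩
    rw [norm_smul, norm_eq_one_of_mem_unitSphere (hΩ hx), mul_one]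
    exact norm_pos_iff.2 (hc₁.trans_le hr1).ne'
  have hgrad : ∀ X ∈ Gam Ω c₁ c₂, (∀ q ∈ Q, f q ≤ opticalPath κ X (Φ q)) →
      f p = opticalPath κ X Y → ∀ v, f' v = κ * inner ℝ (dir (Y - X)) (L v) := by
    intro X hX h he v
    have hG := (hasFDerivAt_opticalPath (κ := κ) (hpos X hX)).comp_hasFDerivWithinAt p hΦ
    exact hdirs.fderiv_eq hf hG h he v
  obtain ⟨K, hK0, hK⟩ := exists_norm_sub_le_mul_dir_sub hΩ hA hc₁
  -- The derivative of `dir (· - X)` vanishes along the ray from `X`, while on the target a point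
  -- depends Lipschitz continuously on this direction; so the ray is not tangent.
  have htrans : ∀ X ∈ Gam Ω c₁ c₂, ∀ v, L v ≠ dir (Y - X) := by
    intro X hX v hv
    have hsub : HasFDerivWithinAt (fun q => Φ q - X) L Q p := hΦ.sub_const X
    have hD := (hasFDerivAt_dir (hpos X hX)).comp_hasFDerivWithinAt p hsub
    have hle := hdirs.norm_le hΦ hD (fun q hq => hK X hX _ (hΦS hq) _ hY) v
    have hz : (‖Y - X‖⁻¹ • (ContinuousLinearMap.id ℝ (Rn n) -
        (innerSL ℝ (dir (Y - X))).smulRight (dir (Y - X)))) (dir (Y - X)) = 0 := by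
      simp [norm_dir (hpos X hX)]
    rw [ContinuousLinearMap.comp_apply, hv, hz, norm_zero, mul_zero, norm_dir (hpos X hX)] at hle
    linarith
  have hinj : Function.Injective L := by
    refine (injective_iff_map_eq_zero L).2 fun v hv => ?_
    have := hdirs.norm_le (hasFDerivWithinAt_id p Q) hΦ hC v
    rw [hv, norm_zero, mul_zero] at this
    simpa using this
  have hdir : dir (Y - X₁) = dir (Y - X₂) := by
    by_contra hne
    set z := dir (Y - X₁) - dir (Y - X₂) with hz
    have hz0 : z ≠ 0 := sub_ne_zero.2 hne
    -- Equal gradients put the image of `L` in the hyperplane orthogonal to `z`; injectivity of `L`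
    -- makes the dimensions match.
    have hrange : LinearMap.range L.toLinearMap = (ℝ ∙ z)ᗮ := by
      have hle : LinearMap.range L.toLinearMap ≤ (ℝ ∙ z)ᗮ := by
        rintro _ ⟨v, rfl⟩
        rw [Submodule.mem_orthogonal_singleton_iff_inner_right, hz, inner_sub_left]
        have e1 := hgrad X₁ hX₁ h₁ he₁ v
        have e2 := hgrad X₂ hX₂ h₂ he₂ v
        exact sub_eq_zero.2 (mul_left_cancel₀ hκ0.ne' (e1.symm.trans e2))
      refine Submodule.eq_of_le_of_finrank_eq hle ?_
      have : Fact (Module.finrank ℝ (Rn n) = (n - 1) + 1) := ⟨by simp; omega⟩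
      rw [Submodule.finrank_orthogonal_span_singleton (n := n - 1) hz0, LinearMap.finrank_range_of_inj hinj]
      simp
    have hne0 : ∀ X ∈ Gam Ω c₁ c₂, inner ℝ z (Y - X) ≠ (0 : ℝ) := by
      intro X hX h0
      have : dir (Y - X) ∈ LinearMap.range L.toLinearMap := by
        rw [hrange, Submodule.mem_orthogonal_singleton_iff_inner_right, dir,
          real_inner_smul_right, h0, mul_zero]
      obtain ⟨v, hv⟩ := this
      exact htrans X hX v hv
    have hcs : inner ℝ (dir (Y - X₁)) (dir (Y - X₂)) ≤ (1 : ℝ) := by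
      have := real_inner_le_norm (dir (Y - X₁)) (dir (Y - X₂))
      rwa [norm_dir (hpos X₁ hX₁), norm_dir (hpos X₂ hX₂), mul_one] at this
    have hz1 : 0 ≤ inner ℝ z (Y - X₁) := by
      have e : Y - X₁ = ‖Y - X₁‖ • dir (Y - X₁) := by
        rw [dir, smul_smul, mul_inv_cancel₀ (hpos X₁ hX₁).ne', one_smul]
      rw [e, real_inner_smul_right, hz, inner_sub_left, real_inner_self_eq_norm_sq,
        norm_dir (hpos X₁ hX₁), real_inner_comm]
      exact mul_nonneg (norm_nonneg _) (by linarith)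
    have hz2 : inner ℝ z (Y - X₂) ≤ 0 := by
      have e : Y - X₂ = ‖Y - X₂‖ • dir (Y - X₂) := by
        rw [dir, smul_smul, mul_inv_cancel₀ (hpos X₂ hX₂).ne', one_smul]
      rw [e, real_inner_smul_right, hz, inner_sub_left, real_inner_self_eq_norm_sq,
        norm_dir (hpos X₂ hX₂)]
      exact mul_nonpos_of_nonneg_of_nonpos (norm_nonneg _) (by linarith)
    -- The sign of `⟨z, Y - X⟩` changes between `X₂` and `X₁`, so some `X ∈ Γ` has its ray to `Y` in
    -- the image of `L`, against transversality.
    have hcont : ContinuousOn (fun X => (inner ℝ z (Y - X) : ℝ)) (Gam Ω c₁ c₂) := by fun_prop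
    obtain ⟨X, hX, h0⟩ := (isPreconnected_Gam hΩconn).intermediate_value hX₂ hX₁ hcont ⟨hz2, hz1⟩
    exact hne0 X hX h0
  exact eq_of_same_ray hκ0 hκ1 (hpos X₁ hX₁) (hpos X₂ hX₂) (hnormX X₁ hX₁) (hnormX X₂ hX₂)
    (hA.refracts X₁ hX₁ Y hY) (hA.refracts X₂ hX₂ Y hY) hdir (he₁.symm.trans he₂)

/-- The direction seen from `X₀`, projected along `x₀`, is a bi-Lipschitz chart. Almost every point
of the chart image would be a density point at which the inverse chart and the dual potential are
differentiable, and there the two supports coincide. So the chart image is null, and its Lipschitz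
preimage is too. -/
theorem hausdorff_multiSupport (hn : 1 ≤ n) (hκ0 : 0 < κ) (hκ1 : κ < 1) (hc₁ : 0 < c₁)
    (hc₂ : c₁ < c₂) (hΩ : Ω ⊆ unitSphere n) (hΩconn : IsPreconnected Ω)
    (hA : HypA κ c₁ c₂ Ω S E s) (hB : HypB κ c₁ c₂ Ω S) {u : Rn n → ℝ}
    (hu : ∀ x ∈ Ω, u x ∈ Icc c₁ c₂) : hausdorff n (multiSupport κ Ω S u) = 0 := by
  rcases (multiSupport κ Ω S u).eq_empty_or_nonempty with h | ⟨Y₀, x₀, hx₀, -⟩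
  · rw [h, measure_empty]
  have hX₀ : c₂ • x₀ ∈ Gam Ω c₁ c₂ := smul_mem_Gam hx₀ ⟨hc₂.le, le_rfl⟩
  have hx₀1 := norm_eq_one_of_mem_unitSphere (hΩ hx₀)
  have hc20 : 0 < c₂ := hc₁.trans hc₂
  set X₀ := c₂ • x₀ with hX₀def
  have hdX₀ : dir X₀ = x₀ := dir_smul hx₀1 hc20
  set M := multiSupport κ Ω S u with hM
  have hMS : M ⊆ S := fun Y ⟨_, _, _, _, _, h, _⟩ => h.1
  have hsel : ∀ Y : Rn n, ∃ x₁ x₂ : Rn n, Y ∈ M → x₁ ∈ Ω ∧ x₂ ∈ Ω ∧ x₁ ≠ x₂ ∧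
      (∀ x ∈ Ω, opticalPath κ (u x₁ • x₁) Y ≤ opticalPath κ (u x • x) Y) ∧
      (∀ x ∈ Ω, opticalPath κ (u x₂ • x₂) Y ≤ opticalPath κ (u x • x) Y) := by
    intro Y
    by_cases hY : Y ∈ M
    · obtain ⟨x₁, hx₁, x₂, hx₂, hne, h1, h2⟩ := hY
      rw [mem_subdiff_iff hκ0 hκ1 hc₁ hΩ hu] at h1 h2
      exact ⟨x₁, x₂, fun _ => ⟨hx₁, hx₂, hne, h1.2, h2.2⟩⟩
    · exact ⟨0, 0, fun h => absurd h hY⟩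
  choose x₁ x₂ hsel using hsel
  obtain ⟨π, hπ1, hπ2⟩ := exists_cap_chart hn hx₀1
  obtain ⟨K, hK0, hK⟩ := exists_norm_sub_le_mul_dir_sub hΩ hA hc₁
  set Ψ : Rn n → Fin (n - 1) → ℝ := fun Y => π (dir (Y - X₀)) with hΨ
  set K' := K * (2 * n / κ) with hK'
  have hK'0 : 0 ≤ K' := by positivity
  have hanti : ∀ Y ∈ M, ∀ Y' ∈ M, ‖Y - Y'‖ ≤ K' * ‖Ψ Y - Ψ Y'‖ := by
    intro Y hY Y' hY'
    have e := hA.refracts X₀ hX₀ Y (hMS hY)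
    have e' := hA.refracts X₀ hX₀ Y' (hMS hY')
    rw [hdX₀, real_inner_comm] at e e'
    have := hπ2 κ hκ0 hκ1.le _ _ (norm_dir (hA.direction hX₀ (hMS hY)).2.2)
      (norm_dir (hA.direction hX₀ (hMS hY')).2.2) e e'
    refine (hK X₀ hX₀ Y (hMS hY) Y' (hMS hY')).trans ?_
    rw [hK', mul_assoc]
    exact mul_le_mul_of_nonneg_left this hK0.le
  have hD : 0 < 2 * (c₂ / κ) := by positivity
  have hΨL : ∀ Y ∈ M, ∀ Y' ∈ M, ‖Ψ Y - Ψ Y'‖ ≤ 2 / (2 * (c₂ / κ)) * ‖Y - Y'‖ := by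
    intro Y hY Y' hY'
    have hb := le_norm_sub_of_hypB hκ0 hc₁ hc₂ hΩ hA hB hX₀ (hMS hY)
    simp only [hΨ]
    rw [← map_sub]
    refine (hπ1 _).trans ((norm_dir_sub_le (hA.direction hX₀ (hMS hY)).2.2
      (hA.direction hX₀ (hMS hY')).2.2).trans ?_)
    rw [sub_sub_sub_cancel_right]
    gcongr
  have hinj : InjOn Ψ M := by
    intro Y hY Y' hY' h
    have := hanti Y hY Y' hY'
    rw [h, sub_self, norm_zero, mul_zero] at this
    exact sub_eq_zero.1 (norm_le_zero_iff.1 this)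
  set Φ := Function.invFunOn Ψ M with hΦ
  have hleft : ∀ Y ∈ M, Φ (Ψ Y) = Y := hinj.leftInvOn_invFunOn
  have hΦlip : LipschitzOnWith K'.toNNReal Φ (Ψ '' M) := by
    refine LipschitzOnWith.of_dist_le_mul ?_
    rintro _ ⟨Y, hY, rfl⟩ _ ⟨Y', hY', rfl⟩
    rw [hleft Y hY, hleft Y' hY', dist_eq_norm, dist_eq_norm, Real.coe_toNNReal _ hK'0]
    exact hanti Y hY Y' hY'
  -- On `M` this is the minimum of the optical path over the refractor, whichever minimizer was
  -- chosen; being a minimum of `κ`-Lipschitz functions of `Y`, it is `κ`-Lipschitz.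
  set φ : Rn n → ℝ := fun Y => opticalPath κ (u (x₁ Y) • x₁ Y) Y with hφ
  have hφle : ∀ Y ∈ M, ∀ Y' ∈ M, φ Y ≤ φ Y' + κ * ‖Y - Y'‖ := by
    intro Y hY Y' hY'
    have e1 := (hsel Y hY).2.2.2.1 _ (hsel Y' hY').1
    have e2 := opticalPath_sub_le hκ0.le (u (x₁ Y') • x₁ Y') Y Y'
    simp only [hφ]
    linarith
  have hφlip : LipschitzOnWith κ.toNNReal φ M := by
    refine LipschitzOnWith.of_dist_le_mul fun Y hY Y' hY' => ?_
    rw [Real.dist_eq, dist_eq_norm, Real.coe_toNNReal _ hκ0.le, abs_le]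
    have e1 := hφle Y hY Y' hY'
    have e2 := hφle Y' hY' Y hY
    rw [norm_sub_rev] at e2
    constructor <;> linarith
  have hΦM : MapsTo Φ (Ψ '' M) M := by
    rintro _ ⟨Y, hY, rfl⟩
    rw [hleft Y hY]; exact hY
  have hflip : LipschitzOnWith (κ.toNNReal * K'.toNNReal) (φ ∘ Φ) (Ψ '' M) :=
    hφlip.comp hΦlip hΦM
  have hvol : volume (Ψ '' M) = 0 := by
    have hae : ∀ᵐ p : Fin (n - 1) → ℝ ∂volume, p ∉ Ψ '' M := by
      filter_upwards [ae_exists_seq_direction volume (Ψ '' M),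
        hΦlip.ae_differentiableWithinAt_of_mem, hflip.ae_differentiableWithinAt_of_mem]
        with p h1 h2 h3 hp
      obtain ⟨hm1, hm2, hne, hs1, hs2⟩ := hsel _ (hΦM hp)
      have hX₁ := smul_mem_Gam hm1 (hu _ hm1)
      have hX₂ := smul_mem_Gam hm2 (hu _ hm2)
      have hφeq : φ (Φ p) = opticalPath κ (u (x₂ (Φ p)) • x₂ (Φ p)) (Φ p) :=
        le_antisymm (hs1 _ hm2) (hs2 _ hm1)
      have heq := eq_of_differentiable_support hn hκ0 hκ1 hc₁ hΩ hΩconn hA hp (h1 hp)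
        (fun q hq => hMS (hΦM hq)) (h2 hp).hasFDerivWithinAt (h3 hp).hasFDerivWithinAt
        (C := 2 / (2 * (c₂ / κ)))
        (by
          rintro _ ⟨Y, hY, rfl⟩
          obtain ⟨Y', hY', rfl⟩ := hp
          rw [hleft Y hY, hleft Y' hY']
          exact hΨL Y hY Y' hY')
        hX₁ hX₂ (fun q hq => (hsel _ (hΦM hq)).2.2.2.1 _ hm1)
        (fun q hq => (hsel _ (hΦM hq)).2.2.2.1 _ hm2) rfl hφeq
      apply hne
      have e1 := dir_smul (norm_eq_one_of_mem_unitSphere (hΩ hm1))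
        (hc₁.trans_le (hu _ hm1).1)
      have e2 := dir_smul (norm_eq_one_of_mem_unitSphere (hΩ hm2))
        (hc₁.trans_le (hu _ hm2).1)
      rw [← e1, ← e2, heq]
    exact measure_eq_zero_iff_ae_notMem.2 hae
  have hfin := hausdorff_le_mul_volume_image hn hanti
  rw [hvol, mul_zero] at hfin
  exact le_antisymm hfin zero_le

end Null

end

/-! ### The measure bound for weak solutions -/

section

variable {n : ℕ}

section MeasureCondition

variable {κ c₁ c₂ : ℝ} {Ω S : Set (Rn n)} {E : Rn n → Set (Rn n)} {s : Rn n → Rn n → ℝ}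
  {u : Rn n → ℝ}

lemma IsRefractor.continuousOn (hκ0 : 0 < κ) (hκ1 : κ < 1) (hc₁ : 0 < c₁)
    (hΩ : Ω ⊆ unitSphere n) (hu : IsRefractor κ c₁ c₂ Ω S u) : ContinuousOn u Ω := by
  have : LipschitzOnWith (κ * c₂ / (1 - κ)).toNNReal u Ω := by
    refine LipschitzOnWith.of_dist_le_mul fun x hx y hy => ?_
    rw [Real.dist_eq, dist_eq_norm]
    exact (abs_refractor_sub_le hκ0 hκ1 hc₁ hΩ hu hx hy).trans
      (mul_le_mul_of_nonneg_right (Real.le_coe_toNNReal _) (norm_nonneg _))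
  exact this.continuousOn

lemma continuous_opticalPath {T : Type*} [TopologicalSpace T] {v w : T → Rn n}
    (hv : Continuous v) (hw : Continuous w) : Continuous fun t => opticalPath κ (v t) (w t) := by
  unfold opticalPath
  fun_prop

/-- Minimality is a closed condition on pairs `(x, Y)`, and projecting along the compact factor `K`
preserves closedness. -/
lemma measurableSet_iUnion_subdiff (hκ0 : 0 < κ) (hκ1 : κ < 1) (hc₁ : 0 < c₁)
    (hΩ : Ω ⊆ unitSphere n) (hS : MeasurableSet S) (hu : IsRefractor κ c₁ c₂ Ω S u)
    {K : Set (Rn n)} (hK : IsCompact K) (hKΩ : K ⊆ Ω) :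
    MeasurableSet (⋃ x ∈ K, subdiff κ Ω S u x) := by
  have : CompactSpace K := isCompact_iff_compactSpace.1 hK
  have hcont : Continuous fun x : K => u x • (x : Rn n) :=
    (continuousOn_iff_continuous_domRestrict.1
      ((hu.continuousOn hκ0 hκ1 hc₁ hΩ).mono hKΩ)).smul continuous_subtype_val
  let D : Set (K × Rn n) := {p | ∀ x ∈ Ω, opticalPath κ (u p.1 • (p.1 : Rn n)) p.2 ≤
    opticalPath κ (u x • x) p.2}
  have hD : IsClosed D := by
    have : D = ⋂ x ∈ Ω, {p : K × Rn n | opticalPath κ (u p.1 • (p.1 : Rn n)) p.2 ≤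
        opticalPath κ (u x • x) p.2} := by
      ext p; simp [D]
    rw [this]
    refine isClosed_biInter fun x _ => isClosed_le ?_ ?_
    · exact continuous_opticalPath (hcont.comp continuous_fst) continuous_snd
    · exact continuous_opticalPath continuous_const continuous_snd
  have himg : (⋃ x ∈ K, subdiff κ Ω S u x) = S ∩ Prod.snd '' D := by
    ext Y
    simp only [mem_iUnion, mem_subdiff_iff hκ0 hκ1 hc₁ hΩ hu.1, mem_inter_iff, mem_image,
      Prod.exists, exists_eq_right, exists_prop]
    constructor
    · rintro ⟨x, hx, hY, h⟩
      exact ⟨hY, ⟨x, hx⟩, h⟩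
    · rintro ⟨hY, ⟨x, hx⟩, h⟩
      exact ⟨x, hx, hY, h⟩
  rw [himg]
  exact hS.inter (isClosedMap_snd_of_compactSpace D hD).measurableSet

lemma measurableSet_iUnion_subdiff_ball (hκ0 : 0 < κ) (hκ1 : κ < 1) (hc₁ : 0 < c₁)
    (hΩ : Ω ⊆ unitSphere n) (hS : MeasurableSet S) (hu : IsRefractor κ c₁ c₂ Ω S u)
    {c : Rn n} {σ : ℝ} (hσ : Metric.ball c σ ∩ unitSphere n ⊆ Ω) :
    MeasurableSet (⋃ x ∈ Metric.ball c σ ∩ unitSphere n, subdiff κ Ω S u x) := by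
  obtain ⟨F, hFc, hFs, hFU, -⟩ := (Metric.isOpen_ball (x := c) (ε := σ)).exists_iUnion_isClosed
  have : (⋃ x ∈ Metric.ball c σ ∩ unitSphere n, subdiff κ Ω S u x) =
      ⋃ k, ⋃ x ∈ F k ∩ unitSphere n, subdiff κ Ω S u x := by
    rw [← hFU, iUnion_inter, biUnion_iUnion]
  rw [this]
  exact MeasurableSet.iUnion fun k => measurableSet_iUnion_subdiff hκ0 hκ1 hc₁ hΩ hS hu
    (isCompact_unitSphere.inter_left (hFc k))
    ((inter_subset_inter_left _ (hFs k)).trans hσ)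

lemma tracing_iUnion_subset {B : Set (Rn n)} (hB : B ⊆ Ω) :
    tracing κ Ω S u (⋃ x ∈ B, subdiff κ Ω S u x) ⊆
      B ∪ tracing κ Ω S u (multiSupport κ Ω S u) := by
  rintro x ⟨hx, Y, hY, hYx⟩
  simp only [mem_iUnion] at hY
  obtain ⟨x', hx', hYx'⟩ := hY
  by_cases h : x = x'
  · exact Or.inl (h ▸ hx')
  · exact Or.inr ⟨hx, Y, ⟨x, hx, x', hB hx', h, hYx, hYx'⟩, hYx⟩

/-- The defining identity of weak solutions speaks of Borel sets only, so `M` is replaced by a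
measurable hull cut down to `S`. -/
lemma sourceMeasure_tracing_null {f : Rn n → ℝ} {ν : Measure (Rn n)} (hS : MeasurableSet S)
    (hν_ac : ν ≪ hausdorff n) (hu : IsWeakSolution κ c₁ c₂ Ω S f ν u) {M : Set (Rn n)}
    (hMS : M ⊆ S) (hM : hausdorff n M = 0) : sourceMeasure Ω f (tracing κ Ω S u M) = 0 := by
  set M' := toMeasurable (hausdorff n) M ∩ S with hM'
  have hM'0 : ν M' = 0 := by
    refine hν_ac (measure_mono_null inter_subset_left ?_)
    rw [measure_toMeasurable, hM]
  have h := hu.2 M' ((measurableSet_toMeasurable _ _).inter hS) inter_subset_right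
  rw [hM'0] at h
  refine measure_mono_null ?_ h
  rintro x ⟨hx, Y, hY, hYx⟩
  exact ⟨hx, Y, ⟨subset_toMeasurable _ _ hY, hMS hY⟩, hYx⟩

lemma exists_sourceMeasure_le {f : Rn n → ℝ}
    (hf : MemLp f ∞ ((hausdorff n).restrict Ω)) :
    ∃ C : ℝ, 0 ≤ C ∧ ∀ B : Set (Rn n), MeasurableSet B →
      sourceMeasure Ω f B ≤ ENNReal.ofReal C * hausdorff n B := by
  set C := (eLpNormEssSup f ((hausdorff n).restrict Ω)) with hC
  have hCtop : C ≠ ∞ := by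
    have := hf.2
    rw [eLpNorm_exponent_top] at this
    exact this.ne
  refine ⟨C.toReal, ENNReal.toReal_nonneg, fun B hB => ?_⟩
  rw [ENNReal.ofReal_toReal hCtop, sourceMeasure, withDensity_apply _ hB]
  have hae : ∀ᵐ x ∂((hausdorff n).restrict Ω).restrict B, ENNReal.ofReal (f x) ≤ C := by
    refine ae_restrict_of_ae ?_
    filter_upwards [ae_le_eLpNormEssSup (f := f) (μ := (hausdorff n).restrict Ω)] with x hx
    refine le_trans ?_ hx
    rw [← ofReal_norm]
    exact ENNReal.ofReal_le_ofReal (le_abs_self _)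
  calc ∫⁻ x in B, ENNReal.ofReal (f x) ∂(hausdorff n).restrict Ω
      ≤ ∫⁻ _ in B, C ∂(hausdorff n).restrict Ω := lintegral_mono_ae hae
    _ = C * (hausdorff n).restrict Ω B := by rw [lintegral_const, Measure.restrict_apply_univ]
    _ ≤ C * hausdorff n B := by gcongr; exact Measure.restrict_le_self

lemma hausdorff_le_mul_of_density_le {ν : Measure (Rn n)} {g : Rn n → ℝ} (hg_meas : Measurable g)
    {α : ℝ} (hg_bdd : ∀ᵐ y ∂((hausdorff n).restrict S), 0 ≤ g y ∧ g y ≤ α)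
    (hg : (hausdorff n).restrict S = ν.withDensity (fun y => ENNReal.ofReal (g y)))
    {A : Set (Rn n)} (hA : MeasurableSet A) (hAS : A ⊆ S) :
    hausdorff n A ≤ ENNReal.ofReal α * ν A := by
  set H := (hausdorff n).restrict S with hH
  have hHA : hausdorff n A = H A := (Measure.restrict_eq_self _ hAS).symm
  have hG : MeasurableSet {y | g y ≤ α} := measurableSet_le hg_meas measurable_const
  -- The bound on `g` is known almost everywhere for `H`, not for `ν`; the exceptional set is
  -- removed before integrating against `ν`.
  have hnull : H (A \ {y | g y ≤ α}) = 0 := by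
    refine measure_mono_null (t := {y | ¬ g y ≤ α}) (fun y hy => hy.2) ?_
    exact ae_iff.1 (hg_bdd.mono fun y hy => hy.2)
  rw [hHA, ← measure_inter_add_sdiff A hG, hnull, add_zero, hg,
    withDensity_apply _ (hA.inter hG)]
  calc ∫⁻ y in A ∩ {y | g y ≤ α}, ENNReal.ofReal (g y) ∂ν
      ≤ ∫⁻ _ in A ∩ {y | g y ≤ α}, ENNReal.ofReal α ∂ν :=
        setLIntegral_mono measurable_const fun y hy => ENNReal.ofReal_le_ofReal hy.2
    _ = ENNReal.ofReal α * ν (A ∩ {y | g y ≤ α}) := by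
        rw [lintegral_const, Measure.restrict_apply_univ]
    _ ≤ ENNReal.ofReal α * ν A := by gcongr; exact inter_subset_left

theorem IsWeakSolution.measureCondition (hn : 1 ≤ n) (hκ0 : 0 < κ) (hκ1 : κ < 1) (hc₁ : 0 < c₁)
    (hc₂ : c₁ < c₂) (hΩ : Ω ⊆ unitSphere n) (hΩconn : IsPreconnected Ω) (hS : MeasurableSet S)
    (hA : HypA κ c₁ c₂ Ω S E s) (hB : HypB κ c₁ c₂ Ω S) {f : Rn n → ℝ}
    (hf : MemLp f ∞ ((hausdorff n).restrict Ω)) {ν : Measure (Rn n)} (hν_ac : ν ≪ hausdorff n)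
    {g : Rn n → ℝ} (hg_meas : Measurable g) {α : ℝ}
    (hg_bdd : ∀ᵐ y ∂((hausdorff n).restrict S), 0 ≤ g y ∧ g y ≤ α)
    (hg : (hausdorff n).restrict S = ν.withDensity (fun y => ENNReal.ofReal (g y)))
    (hu : IsWeakSolution κ c₁ c₂ Ω S f ν u) : MeasureCondition κ Ω S u := by
  obtain ⟨Cf, hCf0, hCf⟩ := exists_sourceMeasure_le hf
  obtain ⟨Cs, hCs0, hCs⟩ := exists_hausdorff_cap_le hn
  refine ⟨max α 0 * (Cf * Cs), fun c σ hσ hcσ => ?_⟩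
  set B := Metric.ball c σ ∩ unitSphere n with hBdef
  set A := ⋃ x ∈ B, subdiff κ Ω S u x with hAdef
  have hAS : A ⊆ S := iUnion₂_subset fun x _ Y hY => hY.1
  have hAm : MeasurableSet A :=
    measurableSet_iUnion_subdiff_ball hκ0 hκ1 hc₁ hΩ hS hu.1 hcσ
  have hBm : MeasurableSet B := measurableSet_ball.inter isCompact_unitSphere.measurableSet
  have hM0 : sourceMeasure Ω f (tracing κ Ω S u (multiSupport κ Ω S u)) = 0 :=
    sourceMeasure_tracing_null hS hν_ac hu (fun Y ⟨_, _, _, _, _, h, _⟩ => h.1)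
      (hausdorff_multiSupport hn hκ0 hκ1 hc₁ hc₂ hΩ hΩconn hA hB hu.1.1)
  have hνA : ν A ≤ ENNReal.ofReal Cf * ENNReal.ofReal (Cs * σ ^ (n - 1)) := by
    rw [← hu.2 A hAm hAS]
    calc sourceMeasure Ω f (tracing κ Ω S u A)
        ≤ sourceMeasure Ω f (B ∪ tracing κ Ω S u (multiSupport κ Ω S u)) :=
          measure_mono (tracing_iUnion_subset hcσ)
      _ ≤ sourceMeasure Ω f B + 0 := (measure_union_le _ _).trans (by rw [hM0])
      _ ≤ ENNReal.ofReal Cf * hausdorff n B := by rw [add_zero]; exact hCf B hBm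
      _ ≤ _ := by gcongr; exact hCs c σ hσ
  calc hausdorff n A ≤ ENNReal.ofReal α * ν A :=
        hausdorff_le_mul_of_density_le hg_meas hg_bdd hg hAm hAS
    _ ≤ ENNReal.ofReal (max α 0) * (ENNReal.ofReal Cf * ENNReal.ofReal (Cs * σ ^ (n - 1))) := by
        gcongr
        exact le_max_left _ _
    _ = ENNReal.ofReal (max α 0 * (Cf * Cs) * σ ^ (n - 1)) := by
        rw [← ENNReal.ofReal_mul hCf0, ← ENNReal.ofReal_mul (le_max_right _ _)]
        congr 1; ring

end MeasureCondition

end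

/-! ### Mixed differences, and the origin of the Hölder exponent -/

section

variable {n : ℕ}

/-- From `(‖a‖ - ‖b‖)(‖a‖ + ‖b‖) = ⟨a - b, a + b⟩` and its primed version: as `a - b` is common to
both, subtraction leaves a factor `a - a'`. -/
lemma norm_mixed_difference_le {a b a' b' : Rn n} (h : a - b = a' - b') :
    |(‖a‖ - ‖b‖) - (‖a'‖ - ‖b'‖)| * (‖a‖ + ‖b‖) ≤ 4 * ‖a - b‖ * ‖a - a'‖ := by
  have hb : b - b' = a - a' := by
    rw [sub_eq_sub_iff_add_eq_add] at h ⊢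
    rw [h, add_comm]
  have e1 : (‖a‖ - ‖b‖) * (‖a‖ + ‖b‖) = inner ℝ (a - b) (a + b) := by
    rw [inner_sub_left, inner_add_right, inner_add_right, real_inner_self_eq_norm_sq,
      real_inner_self_eq_norm_sq, real_inner_comm a b]; ring
  have e2 : (‖a'‖ - ‖b'‖) * (‖a'‖ + ‖b'‖) = inner ℝ (a - b) (a' + b') := by
    rw [h, inner_sub_left, inner_add_right, inner_add_right, real_inner_self_eq_norm_sq,
      real_inner_self_eq_norm_sq, real_inner_comm a' b']; ring
  have e3 : ((‖a‖ - ‖b‖) - (‖a'‖ - ‖b'‖)) * (‖a‖ + ‖b‖) =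
      inner ℝ (a - b) ((a - a') + (b - b')) +
        (‖a'‖ - ‖b'‖) * ((‖a'‖ - ‖a‖) + (‖b'‖ - ‖b‖)) := by
    have : (a - a') + (b - b') = (a + b) - (a' + b') := by abel
    rw [this, inner_sub_right]
    linear_combination e1 - e2
  have hp : 0 ≤ ‖a‖ + ‖b‖ := by positivity
  rw [← abs_of_nonneg hp, ← abs_mul, e3]
  refine (abs_add_le _ _).trans ?_
  have i1 : |inner ℝ (a - b) ((a - a') + (b - b'))| ≤ ‖a - b‖ * (2 * ‖a - a'‖) := by
    refine (abs_real_inner_le_norm _ _).trans ?_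
    gcongr
    refine (norm_add_le _ _).trans ?_
    rw [hb]; linarith
  have i2 : |(‖a'‖ - ‖b'‖) * ((‖a'‖ - ‖a‖) + (‖b'‖ - ‖b‖))| ≤ ‖a - b‖ * (2 * ‖a - a'‖) := by
    rw [abs_mul]
    refine mul_le_mul ?_ ?_ (abs_nonneg _) (norm_nonneg _)
    · rw [h]; exact abs_norm_sub_norm_le _ _
    · refine (abs_add_le _ _).trans ?_
      have j1 := abs_norm_sub_norm_le a' a
      have j2 := abs_norm_sub_norm_le b' b
      rw [norm_sub_rev] at j1 j2
      rw [hb] at j2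
      linarith
  linarith

lemma opticalPath_mixed_le {κ ℓ : ℝ} (hκ0 : 0 < κ) (hℓ : 0 < ℓ) {X X' Y Y' : Rn n}
    (h : ℓ ≤ ‖Y - X‖) :
    |(opticalPath κ X Y - opticalPath κ X Y') - (opticalPath κ X' Y - opticalPath κ X' Y')| ≤
      4 * κ / ℓ * (‖X - X'‖ * ‖Y - Y'‖) := by
  have h1 := norm_mixed_difference_le (a := X - Y) (b := X - Y') (a' := X' - Y) (b' := X' - Y')
    (by abel)
  have e1 : X - Y - (X - Y') = Y' - Y := by abel
  have e2 : X - Y - (X' - Y) = X - X' := by abel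
  rw [e1, e2, norm_sub_rev Y' Y] at h1
  have e3 : (opticalPath κ X Y - opticalPath κ X Y') - (opticalPath κ X' Y - opticalPath κ X' Y') =
      κ * ((‖X - Y‖ - ‖X - Y'‖) - (‖X' - Y‖ - ‖X' - Y'‖)) := by
    unfold opticalPath; ring
  rw [e3, abs_mul, abs_of_pos hκ0]
  set Δ := |(‖X - Y‖ - ‖X - Y'‖) - (‖X' - Y‖ - ‖X' - Y'‖)| with hΔ
  have h2 : Δ * ℓ ≤ 4 * ‖Y - Y'‖ * ‖X - X'‖ := by
    refine le_trans (mul_le_mul_of_nonneg_left ?_ (abs_nonneg _)) h1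
    rw [norm_sub_rev X Y]
    linarith [norm_nonneg (X - Y')]
  have h3 : Δ ≤ 4 * ‖Y - Y'‖ * ‖X - X'‖ / ℓ := (le_div_iff₀ hℓ).2 h2
  calc κ * Δ ≤ κ * (4 * ‖Y - Y'‖ * ‖X - X'‖ / ℓ) := by gcongr
    _ = _ := by ring

section Holder

variable {κ c₁ c₂ : ℝ} {Ω S : Set (Rn n)} {E : Rn n → Set (Rn n)} {s : Rn n → Rn n → ℝ}
  {u : Rn n → ℝ}

lemma norm_refractor_smul_sub_le (hκ0 : 0 < κ) (hκ1 : κ < 1) (hc₁ : 0 < c₁)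
    (hΩ : Ω ⊆ unitSphere n) (hu : IsRefractor κ c₁ c₂ Ω S u) {x y : Rn n} (hx : x ∈ Ω)
    (hy : y ∈ Ω) : ‖u x • x - u y • y‖ ≤ (κ * c₂ / (1 - κ) + c₂) * ‖x - y‖ := by
  have h1 := abs_refractor_sub_le hκ0 hκ1 hc₁ hΩ hu hx hy
  have h2 : u x • x - u y • y = (u x - u y) • x + u y • (x - y) := by module
  have hy0 : 0 ≤ u y := hc₁.le.trans (hu.1 y hy).1
  rw [h2, add_mul]
  refine (norm_add_le _ _).trans (add_le_add ?_ ?_)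
  · rwa [norm_smul, norm_eq_one_of_mem_unitSphere (hΩ hx), mul_one, Real.norm_eq_abs]
  · rw [norm_smul, Real.norm_of_nonneg hy0]
    exact mul_le_mul_of_nonneg_right (hu.1 y hy).2 (norm_nonneg _)

/-- The optical path to a supporting point `Y₂` of `x₂` is almost minimal at `x₁`. -/
lemma exists_opticalPath_cross_le (hκ0 : 0 < κ) (hκ1 : κ < 1) (hc₁ : 0 < c₁)
    (hc₂ : c₁ < c₂) (hΩ : Ω ⊆ unitSphere n) (hA : HypA κ c₁ c₂ Ω S E s) (hB : HypB κ c₁ c₂ Ω S)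
    (hu : IsRefractor κ c₁ c₂ Ω S u) :
    ∃ C : ℝ, 0 < C ∧ (∀ x ∈ Ω, ∀ x' ∈ Ω, ∀ Y ∈ S, ∀ Y' ∈ S,
        |(opticalPath κ (u x • x) Y - opticalPath κ (u x • x) Y') -
          (opticalPath κ (u x' • x') Y - opticalPath κ (u x' • x') Y')| ≤
            C * (‖x - x'‖ * ‖Y - Y'‖)) ∧
      ∀ x₁ ∈ Ω, ∀ x₂ ∈ Ω, ∀ Y₁ ∈ subdiff κ Ω S u x₁, ∀ Y₂ ∈ subdiff κ Ω S u x₂,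
        opticalPath κ (u x₁ • x₁) Y₂ ≤
          opticalPath κ (u x₂ • x₂) Y₂ + C * (‖x₁ - x₂‖ * ‖Y₁ - Y₂‖) := by
  have hc20 : 0 < c₂ := hc₁.trans hc₂
  have hℓ : 0 < 2 * (c₂ / κ) := by positivity
  have hk : 0 < 1 - κ := by linarith
  set Λ := κ * c₂ / (1 - κ) + c₂ with hΛ
  have hΛ0 : 0 < Λ := by positivity
  set C := 4 * κ / (2 * (c₂ / κ)) * Λ with hC
  have hmix : ∀ x ∈ Ω, ∀ x' ∈ Ω, ∀ Y ∈ S, ∀ Y' ∈ S,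
        |(opticalPath κ (u x • x) Y - opticalPath κ (u x • x) Y') -
          (opticalPath κ (u x' • x') Y - opticalPath κ (u x' • x') Y')| ≤
            C * (‖x - x'‖ * ‖Y - Y'‖) := by
    intro x hx x' hx' Y hY Y' hY'
    have h1 := le_norm_sub_of_hypB hκ0 hc₁ hc₂ hΩ hA hB (smul_mem_Gam hx (hu.1 x hx)) hY
    refine (opticalPath_mixed_le hκ0 hℓ h1).trans ?_
    rw [hC, mul_assoc, ← mul_assoc Λ]
    gcongr
    exact norm_refractor_smul_sub_le hκ0 hκ1 hc₁ hΩ hu hx hx'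
  refine ⟨C, by positivity, hmix, ?_⟩
  intro x₁ hx₁ x₂ hx₂ Y₁ hY₁ Y₂ hY₂
  rw [mem_subdiff_iff hκ0 hκ1 hc₁ hΩ hu.1] at hY₁ hY₂
  -- Minimality of `x₁` for `Y₁` passes to `Y₂` at the cost of a mixed difference.
  have h1 := hY₁.2 x₂ hx₂
  have h2 := (abs_le.1 (hmix x₁ hx₁ x₂ hx₂ Y₁ hY₁.1 Y₂ hY₂.1)).1
  linarith

/-- A point of the target whose optical path is larger outside a ball than at its center supports
the refractor at some point of the ball. -/
lemma mem_iUnion_subdiff_of_lt (hκ0 : 0 < κ) (hκ1 : κ < 1) (hc₁ : 0 < c₁)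
    (hΩ : Ω ⊆ unitSphere n) (hu : IsRefractor κ c₁ c₂ Ω S u) {x₁ Y : Rn n} (hx₁ : x₁ ∈ Ω)
    (hY : Y ∈ S) {η : ℝ} (hη : 0 < η) (hball : Metric.ball x₁ (2 * η) ∩ unitSphere n ⊆ Ω)
    (hout : ∀ x ∈ Ω, η ≤ ‖x - x₁‖ →
      opticalPath κ (u x₁ • x₁) Y ≤ opticalPath κ (u x • x) Y) :
    Y ∈ ⋃ x ∈ Metric.ball x₁ (2 * η) ∩ unitSphere n, subdiff κ Ω S u x := by
  -- A minimizer over the compact ball of radius `η` is global, since outside this ball the value at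
  -- `x₁` is already no larger.
  have hsub : Metric.closedBall x₁ η ⊆ Metric.ball x₁ (2 * η) :=
    Metric.closedBall_subset_ball (by linarith)
  set B := Metric.closedBall x₁ η ∩ unitSphere n with hB
  have hBΩ : B ⊆ Ω := (inter_subset_inter_left _ hsub).trans hball
  have hBc : IsCompact B := isCompact_unitSphere.inter_left Metric.isClosed_closedBall
  have hx₁B : x₁ ∈ B := ⟨Metric.mem_closedBall_self hη.le, hΩ hx₁⟩
  have hcont : ContinuousOn (fun x => opticalPath κ (u x • x) Y) B := by
    have h1 : ContinuousOn u B := (hu.continuousOn hκ0 hκ1 hc₁ hΩ).mono hBΩ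
    unfold opticalPath
    fun_prop
  obtain ⟨z, hz, hmin⟩ := hBc.exists_isMinOn ⟨x₁, hx₁B⟩ hcont
  refine mem_iUnion₂.2 ⟨z, ⟨hsub hz.1, hz.2⟩, ?_⟩
  rw [mem_subdiff_iff hκ0 hκ1 hc₁ hΩ hu.1]
  refine ⟨hY, fun x hx => ?_⟩
  by_cases hxB : ‖x - x₁‖ ≤ η
  · exact hmin ⟨by rwa [Metric.mem_closedBall, dist_eq_norm], hΩ hx⟩
  · exact (hmin hx₁B).trans (hout x hx (le_of_not_ge hxB))

end Holder

lemma le_two_mul_rpow {δ γ : ℝ} (hδ0 : 0 ≤ δ) (hδ2 : δ ≤ 2) (hγ0 : 0 < γ) (hγ1 : γ ≤ 1) :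
    δ ≤ 2 * δ ^ γ := by
  rcases hδ0.eq_or_lt with rfl | hδ
  · rw [Real.zero_rpow hγ0.ne', mul_zero]
  rcases le_or_gt δ 1 with hd | hd
  · have := Real.rpow_le_rpow_of_exponent_ge hδ hd hγ1
    rw [Real.rpow_one] at this
    linarith
  · linarith [Real.one_le_rpow hd.le hγ0.le]

/-- Optimization in `η`: the smallest admissible choice has `L η² = C₆ δ`, and squaring
`L^(2(n-2)+1) ≤ C₅ η` gives `L^(4n-5) ≤ C₅² C₆ δ`. -/
lemma holder_scalar {C₅ C₆ η₀ L δ : ℝ} (hC₅ : 0 ≤ C₅) (hC₆ : 0 < C₆) (hη₀ : 0 < η₀)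
    (hL : 0 ≤ L) (hδ0 : 0 ≤ δ) (hδ2 : δ ≤ 2) (hn : 2 ≤ n)
    (h : 0 < L → ∀ η, 0 < η → η ≤ η₀ → C₆ * δ ≤ L * η ^ 2 → (L ^ 2) ^ (n - 2) * L ≤ C₅ * η) :
    L ≤ ((C₅ ^ 2 * C₆) ^ (1 / (4 * (n : ℝ) - 5)) + C₆ / η₀ ^ 2 * 2) *
      δ ^ (1 / (4 * (n : ℝ) - 5)) := by
  have hn' : (2 : ℝ) ≤ n := by exact_mod_cast hn
  have hγ0 : 0 < 1 / (4 * (n : ℝ) - 5) := by apply one_div_pos.2; linarith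
  have hγ1 : 1 / (4 * (n : ℝ) - 5) ≤ 1 := by
    rw [div_le_one (by linarith)]; linarith
  set γ := 1 / (4 * (n : ℝ) - 5) with hγ
  rcases hL.eq_or_lt with rfl | hL0
  · positivity
  have h := h hL0
  -- For `δ = 0` every small `η` is admissible, which is impossible with `L > 0`.
  rcases hδ0.eq_or_lt with rfl | hδ
  · exfalso
    set P := (L ^ 2) ^ (n - 2) * L with hP
    have hP0 : 0 < P := by positivity
    set η := min η₀ (P / (2 * (C₅ + 1))) with hη
    have hη0 : 0 < η := lt_min hη₀ (by positivity)
    have h1 := h η hη0 (min_le_left _ _) (by rw [mul_zero]; positivity)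
    have h2 : η * (2 * (C₅ + 1)) ≤ P :=
      (le_div_iff₀ (by positivity)).1 (min_le_right _ _)
    nlinarith
  · set η := √(C₆ * δ / L) with hη
    have hη0 : 0 < η := Real.sqrt_pos.2 (by positivity)
    have hηsq : η ^ 2 = C₆ * δ / L := Real.sq_sqrt (by positivity)
    have hLη : L * η ^ 2 = C₆ * δ := by rw [hηsq]; field_simp
    rw [add_mul]
    rcases le_or_gt η η₀ with hle | hlt
    · have h1 := h η hη0 hle hLη.ge
      have h2 : L ^ (4 * (n - 2) + 3) ≤ C₅ ^ 2 * C₆ * δ := by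
        calc L ^ (4 * (n - 2) + 3) = ((L ^ 2) ^ (n - 2) * L) ^ 2 * L := by
              rw [mul_pow, ← pow_mul, ← pow_mul, ← pow_add, ← pow_succ]; congr 1; ring
          _ ≤ (C₅ * η) ^ 2 * L := by gcongr
          _ = C₅ ^ 2 * (L * η ^ 2) := by ring
          _ = _ := by rw [hLη]; ring
      have h3 : L = (L ^ (4 * (n - 2) + 3)) ^ γ := by
        rw [← Real.rpow_natCast, ← Real.rpow_mul hL0.le]
        have : ((4 * (n - 2) + 3 : ℕ) : ℝ) * γ = 1 := by
          rw [hγ]; push_cast [hn]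
          have : 4 * (n : ℝ) - 5 ≠ 0 := by linarith
          field_simp; ring
        rw [this, Real.rpow_one]
      have h4 : L ≤ (C₅ ^ 2 * C₆) ^ γ * δ ^ γ := by
        rw [← Real.mul_rpow (by positivity) hδ.le]
        rw [h3]
        exact Real.rpow_le_rpow (by positivity) h2 hγ0.le
      exact h4.trans (le_add_of_nonneg_right (by positivity))
    -- When the optimal `η` exceeds `η₀`, already `L` is at most linear in `δ`.
    · have h1 : L ≤ C₆ / η₀ ^ 2 * δ := by
        have : L * η₀ ^ 2 ≤ C₆ * δ := by rw [← hLη]; gcongr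
        rw [div_mul_eq_mul_div, le_div_iff₀ (by positivity)]
        exact this
      have h2 : δ ≤ 2 * δ ^ γ := le_two_mul_rpow hδ0 hδ2 hγ0 hγ1
      have h3 : C₆ / η₀ ^ 2 * δ ≤ C₆ / η₀ ^ 2 * (2 * δ ^ γ) := by gcongr
      rw [mul_assoc (C₆ / η₀ ^ 2)]
      exact (h1.trans h3).trans (le_add_of_nonneg_left (by positivity))

end

/-! ### Hölder continuity of the supporting point -/

section

variable {n : ℕ} {κ c₁ c₂ : ℝ} {Ω S : Set (Rn n)} {E : Rn n → Set (Rn n)} {s : Rn n → Rn n → ℝ}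
  {u : Rn n → ℝ}

/-- Hölder continuity of the map `x ↦ ∂u(x)`; in particular `∂u(x)` has only one element. -/
theorem exists_subdiff_holder (hn : 2 ≤ n) (hκ0 : 0 < κ) (hκ1 : κ < 1) (hc₁ : 0 < c₁)
    (hc₂ : c₁ < c₂) {U : Set (Rn n)} (hU : IsOpen U) (hΩU : Ω = U ∩ unitSphere n)
    (hA : HypA κ c₁ c₂ Ω S E s) (hB : HypB κ c₁ c₂ Ω S) (hC : HypC κ c₁ c₂ Ω E s)
    (hD : HypD κ c₁ c₂ Ω S s) (hu : IsRefractor κ c₁ c₂ Ω S u) (hM : MeasureCondition κ Ω S u)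
    {K : Set (Rn n)} (hK : IsCompact K) (hKΩ : K ⊆ Ω) :
    ∃ C : ℝ, 0 ≤ C ∧ ∀ x₁ ∈ K, ∀ x₂ ∈ Ω, ∀ Y₁ ∈ subdiff κ Ω S u x₁, ∀ Y₂ ∈ subdiff κ Ω S u x₂,
      ‖Y₁ - Y₂‖ ≤ C * ‖x₁ - x₂‖ ^ (1 / (4 * (n : ℝ) - 5)) := by
  have hΩ : Ω ⊆ unitSphere n := hΩU ▸ inter_subset_right
  obtain ⟨CM, hCM⟩ := hM
  obtain ⟨μ₀, CD, hμ₀, hCD0, hCD⟩ := hD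
  obtain ⟨c, C₀, hc0, hC₀0, hgain⟩ := exists_opticalPath_gain hκ0 hκ1 hc₁ hc₂ hΩ hA hB hC
  obtain ⟨Cx, hCx0, hmix, hcross⟩ := exists_opticalPath_cross_le hκ0 hκ1 hc₁ hc₂ hΩ hA hB hu
  obtain ⟨R, hR0, hR⟩ := exists_norm_sub_le hΩ hA hc₁
  obtain ⟨ε, hε0, hε⟩ := hK.exists_thickening_subset_open hU
    (hKΩ.trans (hΩU ▸ inter_subset_left))
  -- The constants split the gain in half: a target displacement below `a L² η` costs at most `c L²
  -- t² / 2` at distance `t ≥ η`, and `C₆ δ ≤ L η²` makes the cross error at most `c L² η² / 2`.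
  set a := c / (2 * Cx) with ha
  have ha0 : 0 < a := by positivity
  set C₆ := 2 * C₀ * Cx / c with hC₆
  set C₅ := max CM 0 * 2 ^ (n - 1) / (CD * a ^ (n - 2)) with hC₅
  -- The first bound keeps the ball of radius `2η` inside `Ω`, the second keeps the thickness `a L²
  -- η` in the range of H.D.
  set η₀ := min (ε / 2) (μ₀ / (a * (2 * R) ^ 2)) with hη₀
  have hη₀0 : 0 < η₀ := lt_min (by positivity) (by positivity)
  have hC₆0 : 0 < C₆ := by positivity
  have hC₅0 : 0 ≤ C₅ := by
    have := le_max_right CM 0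
    positivity
  refine ⟨(C₅ ^ 2 * C₆) ^ (1 / (4 * (n : ℝ) - 5)) + C₆ / η₀ ^ 2 * 2, by positivity, ?_⟩
  intro x₁ hx₁K x₂ hx₂ Y₁ hY₁ Y₂ hY₂
  have hx₁ := hKΩ hx₁K
  have hYS₁ : Y₁ ∈ S := hY₁.1
  have hYS₂ : Y₂ ∈ S := hY₂.1
  have hX₁ := smul_mem_Gam hx₁ (hu.1 x₁ hx₁)
  have hδ2 : ‖x₁ - x₂‖ ≤ 2 := by
    refine (norm_sub_le _ _).trans ?_
    rw [norm_eq_one_of_mem_unitSphere (hΩ hx₁), norm_eq_one_of_mem_unitSphere (hΩ hx₂)]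
    norm_num
  have hL2 : ‖Y₁ - Y₂‖ ≤ 2 * R := by
    have h1 := hR _ hX₁ Y₁ hYS₁
    have h2 := hR _ hX₁ Y₂ hYS₂
    rw [norm_sub_rev] at h2
    linarith [norm_sub_le_norm_sub_add_norm_sub Y₁ (u x₁ • x₁) Y₂]
  have hcr := hcross x₁ hx₁ x₂ hx₂ Y₁ hY₁ Y₂ hY₂
  have hmin₁ := ((mem_subdiff_iff hκ0 hκ1 hc₁ hΩ hu.1).1 hY₁).2
  have hmin₂ := ((mem_subdiff_iff hκ0 hκ1 hc₁ hΩ hu.1).1 hY₂).2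
  refine holder_scalar hC₅0 hC₆0 hη₀0 (norm_nonneg _) (norm_nonneg _) hδ2 hn ?_
  intro hL η hη hηη₀ hδη
  set L := ‖Y₁ - Y₂‖ with hLdef
  set δ := ‖x₁ - x₂‖ with hδdef
  have hδ0 : 0 ≤ δ := norm_nonneg _
  set μ := a * L ^ 2 * η with hμ
  have hμ0 : 0 < μ := by positivity
  have hμμ₀ : μ ≤ μ₀ := by
    have h1 : η ≤ μ₀ / (a * (2 * R) ^ 2) := hηη₀.trans (min_le_right _ _)
    rw [le_div_iff₀ (by positivity)] at h1
    calc μ ≤ a * (2 * R) ^ 2 * η := by rw [hμ]; gcongr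
      _ ≤ μ₀ := by linarith
  have hball : Metric.ball x₁ (2 * η) ∩ unitSphere n ⊆ Ω := by
    rw [hΩU]
    refine inter_subset_inter_left _ ?_
    have h1 : 2 * η ≤ ε := by
      have := hηη₀.trans (min_le_left _ _)
      linarith
    exact (Metric.ball_subset_ball h1).trans ((Metric.ball_subset_thickening hx₁K ε).trans hε)
  have hcδ : C₀ * (Cx * (δ * L)) ≤ c * L ^ 2 * η ^ 2 / 2 := by
    have h1 : C₆ * δ * (L * c / 2) ≤ L * η ^ 2 * (L * c / 2) := by gcongr
    have h2 : C₆ * δ * (L * c / 2) = C₀ * (Cx * (δ * L)) := by rw [hC₆]; field_simp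
    linarith
  have hsub : Metric.thickening μ
      (targetCurvePt κ s (u x₁ • x₁) Y₁ Y₂ '' Icc (1 / 4 : ℝ) (3 / 4)) ∩ S ⊆
      ⋃ x ∈ Metric.ball x₁ (2 * η) ∩ unitSphere n, subdiff κ Ω S u x := by
    rintro Y ⟨hYt, hYS⟩
    rw [Metric.mem_thickening_iff] at hYt
    obtain ⟨_, ⟨l, hl, rfl⟩, hdist⟩ := hYt
    refine mem_iUnion_subdiff_of_lt hκ0 hκ1 hc₁ hΩ hu hx₁ hYS hη hball fun x hx hηx => ?_
    have hl' : l ∈ Icc (0 : ℝ) 1 := ⟨by linarith [hl.1], by linarith [hl.2]⟩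
    have hg := hgain x₁ hx₁ (u x₁) (hu.1 x₁ hx₁) x hx (u x) (hu.1 x hx) Y₁ hYS₁ Y₂ hYS₂ l hl
      (Cx * (δ * L)) (by positivity)
      (by
        have h1 := hmin₁ x hx
        have h2 : 0 ≤ Cx * (δ * L) := by positivity
        linarith)
      (by linarith [hmin₂ x hx])
    have hYl := targetCurvePt_mem hA hX₁ hYS₁ hYS₂ hl'
    set Yl := targetCurvePt κ s (u x₁ • x₁) Y₁ Y₂ l
    have hmx := (abs_le.1 (hmix x hx x₁ hx₁ Y hYS Yl hYl)).1
    rw [dist_eq_norm] at hdist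
    set t := ‖x - x₁‖
    have ht0 : 0 ≤ t := norm_nonneg _
    have e1 : Cx * (t * ‖Y - Yl‖) ≤ c * L ^ 2 * t ^ 2 / 2 := by
      calc Cx * (t * ‖Y - Yl‖) ≤ Cx * (t * (a * L ^ 2 * t)) := by
            gcongr
            exact hdist.le.trans (by rw [hμ]; gcongr)
        _ = _ := by rw [ha]; field_simp
    have e2 : c * L ^ 2 * η ^ 2 / 2 ≤ c * L ^ 2 * t ^ 2 / 2 := by gcongr
    rw [← hLdef] at hg
    linarith
  have hmeas := (hCD _ hX₁ Y₁ hYS₁ Y₂ hYS₂ μ hμ0 hμμ₀).trans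
    ((measure_mono hsub).trans (hCM x₁ (2 * η) (by positivity) hball))
  have hreal : CD * μ ^ (n - 2) * L ≤ max CM 0 * (2 * η) ^ (n - 1) := by
    have h1 : CD * μ ^ (n - 2) * L ≤ CM * (2 * η) ^ (n - 1) := by
      rcases ENNReal.ofReal_le_ofReal_iff'.1 hmeas with h | h
      · exact h
      · have : 0 < CD * μ ^ (n - 2) * L := by positivity
        exact absurd h (not_le.2 this)
    exact h1.trans (mul_le_mul_of_nonneg_right (le_max_left _ _) (by positivity))
  have hpow : (2 * η) ^ (n - 1) = 2 ^ (n - 1) * (η ^ (n - 2) * η) := by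
    rw [mul_pow, ← pow_succ]; congr 2; omega
  rw [hpow, hμ, mul_pow, mul_pow] at hreal
  rw [hC₅, div_mul_eq_mul_div, le_div_iff₀ (by positivity)]
  refine le_of_mul_le_mul_right ?_ (pow_pos hη (n - 2))
  linarith

end

/-! ### Differentiability of the refractor and Hölder continuity of its gradient -/

section

variable {n : ℕ} {κ c₁ c₂ : ℝ} {Ω S : Set (Rn n)} {E : Rn n → Set (Rn n)} {s : Rn n → Rn n → ℝ}
  {u : Rn n → ℝ}

/-- The tangential gradient at `x` of a refractor of polar radius `r` that refracts `x` into the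
direction `e`. -/
def refractorGradient (κ r : ℝ) (x e : Rn n) : Rn n :=
  (κ * r / (1 - κ * inner ℝ e x)) • (e - (inner ℝ e x : ℝ) • x)

open Filter Topology Asymptotics in
/-- Implicit differentiation: if `Φ (v X, X)` is stationary at `x₀` and `∂Φ/∂r ≠ 0`, then `v` is
differentiable. -/
lemma hasFDerivAt_of_stationary {V : Type*} [NormedAddCommGroup V] [NormedSpace ℝ V]
    {Φ : ℝ × V → ℝ} {v : V → ℝ} {x₀ : V} {Φ' : ℝ × V →L[ℝ] ℝ} {v' : V →L[ℝ] ℝ}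
    (hΦ : HasFDerivAt Φ Φ' (v x₀, x₀)) (h0 : Φ' (1, 0) ≠ 0)
    (hv' : ∀ w, Φ' (1, 0) * v' w + Φ' (0, w) = 0)
    (hv : (fun X => v X - v x₀) =O[𝓝 x₀] fun X => X - x₀)
    (hst : (fun X => Φ (v X, X) - Φ (v x₀, x₀)) =o[𝓝 x₀] fun X => X - x₀) :
    HasFDerivAt v v' x₀ := by
  have hO : (fun X => (v X, X) - (v x₀, x₀)) =O[𝓝 x₀] fun X => X - x₀ := by
    have : (fun X => (v X, X) - (v x₀, x₀)) = fun X => (v X - v x₀, X - x₀) := rfl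
    rw [this]
    exact hv.prod_left (isBigO_refl _ _)
  have hto : Tendsto (fun X => (v X, X)) (𝓝 x₀) (𝓝 (v x₀, x₀)) := by
    refine Tendsto.prodMk_nhds ?_ tendsto_id
    have h1 : Tendsto (fun X => X - x₀) (𝓝 x₀) (𝓝 0) := by
      simpa using (continuous_id.sub continuous_const).tendsto (f := fun X => X - x₀) x₀
    have h2 := hv.trans_tendsto h1
    simpa using h2.add_const (v x₀)
  have h1 := (hΦ.isLittleO.comp_tendsto hto).trans_isBigO hO
  have h2 := hst.sub h1
  have h3 := h2.const_mul_left (Φ' (1, 0))⁻¹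
  refine HasFDerivAt.of_isLittleO (h3.congr_left fun X => ?_)
  have e : Φ' ((v X, X) - (v x₀, x₀)) = Φ' (1, 0) * (v X - v x₀) + Φ' (0, X - x₀) := by
    have : ((v X, X) - (v x₀, x₀) : ℝ × V) = (v X - v x₀) • (1, 0) + (0, X - x₀) := by
      ext <;> simp
    rw [this, map_add, map_smul, smul_eq_mul, mul_comm]
  simp only [Function.comp_apply]
  rw [e]
  have hw := hv' (X - x₀)
  field_simp
  linarith

lemma refraction_denominator_pos (hκ0 : 0 < κ) (hκ1 : κ < 1) {x e : Rn n} (hx : ‖x‖ = 1)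
    (he : ‖e‖ = 1) : 0 < 1 - κ ∧ 1 - κ ≤ 1 - κ * inner ℝ e x := by
  have h := real_inner_le_norm e x
  rw [hx, he, mul_one] at h
  exact ⟨by linarith, by nlinarith⟩

open Filter Topology Asymptotics in
-- The optical path to `Y₀` along the refractor is minimal at `x₀` and exceeds its minimum by at
-- most `C |x - x₀| |Y - Y₀|` for `Y ∈ ∂u(x)`. Hölder continuity makes this `o(|x - x₀|)`, so
-- implicit differentiation applies, the radial derivative being `1 - κ ⟨e, x₀⟩ > 0`.
lemma hasFDerivAt_radialExt (hn : 2 ≤ n) (hκ0 : 0 < κ) (hκ1 : κ < 1) (hc₁ : 0 < c₁)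
    (hc₂ : c₁ < c₂) {U : Set (Rn n)} (hU : IsOpen U) (hΩU : Ω = U ∩ unitSphere n)
    (hA : HypA κ c₁ c₂ Ω S E s) (hB : HypB κ c₁ c₂ Ω S) (hC : HypC κ c₁ c₂ Ω E s)
    (hD : HypD κ c₁ c₂ Ω S s) (hu : IsRefractor κ c₁ c₂ Ω S u) (hM : MeasureCondition κ Ω S u)
    {x₀ Y₀ : Rn n} (hx₀ : x₀ ∈ Ω) (hY₀ : Y₀ ∈ subdiff κ Ω S u x₀) :
    HasFDerivAt (radialExt u)
      (innerSL ℝ (refractorGradient κ (u x₀) x₀ (dir (Y₀ - u x₀ • x₀)))) x₀ := by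
  have hΩ : Ω ⊆ unitSphere n := hΩU ▸ inter_subset_right
  have hx1 := norm_eq_one_of_mem_unitSphere (hΩ hx₀)
  have hx0 : 0 < ‖x₀‖ := by rw [hx1]; exact one_pos
  have hdx : dir x₀ = x₀ := by rw [dir, hx1, inv_one, one_smul]
  have hX₀ := smul_mem_Gam hx₀ (hu.1 x₀ hx₀)
  have hpos := (hA.direction hX₀ hY₀.1).2.2
  set e := dir (Y₀ - u x₀ • x₀) with he
  have he1 : ‖e‖ = 1 := norm_dir hpos
  obtain ⟨hκp, hden⟩ := refraction_denominator_pos hκ0 hκ1 hx1 he1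
  have hv₀ : radialExt u x₀ = u x₀ := by rw [radialExt, hdx]
  let Dd : Rn n →L[ℝ] Rn n := ContinuousLinearMap.id ℝ (Rn n) - (innerSL ℝ x₀).smulRight x₀
  have hDd : HasFDerivAt (dir : Rn n → Rn n) Dd x₀ := by
    have := hasFDerivAt_dir hx0
    rwa [hdx, hx1, inv_one, one_smul] at this
  have hΦ : HasFDerivAt (fun p : ℝ × Rn n => p.1 + κ * ‖Y₀ - p.1 • dir p.2‖)
      (ContinuousLinearMap.fst ℝ ℝ (Rn n) + κ • (innerSL ℝ e).comp
        (-(u x₀ • Dd.comp (ContinuousLinearMap.snd ℝ ℝ (Rn n)) +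
          (ContinuousLinearMap.fst ℝ ℝ (Rn n)).smulRight x₀))) (radialExt u x₀, x₀) := by
    rw [hv₀]
    have h1 : HasFDerivAt (fun p : ℝ × Rn n => dir p.2)
        (Dd.comp (ContinuousLinearMap.snd ℝ ℝ (Rn n))) (u x₀, x₀) :=
      HasFDerivAt.comp (g := dir) (u x₀, x₀) hDd hasFDerivAt_snd
    have h2 : HasFDerivAt (fun p : ℝ × Rn n => p.1 • dir p.2) _ (u x₀, x₀) :=
      (hasFDerivAt_fst (𝕜 := ℝ) (E := ℝ) (F := Rn n) (p := (u x₀, x₀))).smul h1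
    have h3 := h2.const_sub Y₀
    have h4 : HasFDerivAt (fun w : Rn n => ‖w‖) (innerSL ℝ e) (Y₀ - u x₀ • dir x₀) := by
      rw [hdx]; exact hasFDerivAt_norm_dir hpos
    have h5 := (HasFDerivAt.comp (g := fun w : Rn n => ‖w‖) (u x₀, x₀) h4 h3).const_mul κ
    have h6 := (hasFDerivAt_fst (𝕜 := ℝ) (E := ℝ) (F := Rn n) (p := (u x₀, x₀))).add h5
    simp only [hdx] at h6
    exact h6
  -- points near `x₀` project into `Ω`
  have hnear : ∀ᶠ X in 𝓝 x₀, dir X ∈ Ω ∧ 0 < ‖X‖ := by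
    have hc : ContinuousAt (dir : Rn n → Rn n) x₀ := hDd.continuousAt
    have hxU : dir x₀ ∈ U := by rw [hdx]; exact (hΩU ▸ hx₀ : x₀ ∈ U ∩ unitSphere n).1
    have h1 := hc.eventually (hU.mem_nhds hxU)
    have h2 : ∀ᶠ X : Rn n in 𝓝 x₀, 0 < ‖X‖ :=
      continuous_norm.continuousAt.eventually (lt_mem_nhds hx0)
    filter_upwards [h1, h2] with X hX1 hX2
    refine ⟨?_, hX2⟩
    rw [hΩU]
    exact ⟨hX1, by rw [unitSphere, mem_sphere_zero_iff_norm, norm_dir hX2]⟩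
  have hdist : ∀ X : Rn n, 0 < ‖X‖ → ‖dir X - x₀‖ ≤ 2 * ‖X - x₀‖ := by
    intro X hX
    have := norm_dir_sub_le hx0 hX
    rwa [hdx, hx1, div_one, norm_sub_rev, norm_sub_rev x₀] at this
  obtain ⟨Ch, hCh0, hCh⟩ := exists_subdiff_holder hn hκ0 hκ1 hc₁ hc₂ hU hΩU hA hB hC hD hu hM
    (isCompact_singleton (x := x₀)) (singleton_subset_iff.2 hx₀)
  obtain ⟨Cx, hCx0, -, hcross⟩ := exists_opticalPath_cross_le hκ0 hκ1 hc₁ hc₂ hΩ hA hB hu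
  have hn' : (2 : ℝ) ≤ n := by exact_mod_cast hn
  have hγ0 : 0 < 1 / (4 * (n : ℝ) - 5) := by apply one_div_pos.2; linarith
  set γ := 1 / (4 * (n : ℝ) - 5) with hγ
  have hΦG : ∀ X, dir X ∈ Ω →
      radialExt u X + κ * ‖Y₀ - radialExt u X • dir X‖ =
        opticalPath κ (u (dir X) • dir X) Y₀ := by
    intro X hX
    rw [opticalPath, radialExt, norm_smul, norm_eq_one_of_mem_unitSphere (hΩ hX), mul_one,
      Real.norm_of_nonneg (hc₁.le.trans (hu.1 _ hX).1), norm_sub_rev]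
  refine hasFDerivAt_of_stationary hΦ ?_ ?_ ?_ ?_
  · simp
    linarith
  · intro w
    have hin : inner ℝ e (Dd w) = inner ℝ e w - inner ℝ x₀ w * inner ℝ e x₀ := by
      simp only [Dd, sub_apply, ContinuousLinearMap.id_apply,
        ContinuousLinearMap.smulRight_apply, innerSL_apply_apply, inner_sub_right,
        real_inner_smul_right]
    simp only [add_apply, smul_apply, ContinuousLinearMap.comp_apply, neg_apply,
      ContinuousLinearMap.coe_fst', ContinuousLinearMap.coe_snd',
      ContinuousLinearMap.smulRight_apply, innerSL_apply_apply, map_zero, smul_zero, zero_add,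
      one_smul, zero_smul, add_zero, inner_neg_right, real_inner_smul_right, smul_eq_mul, hin,
      refractorGradient, real_inner_smul_left, inner_sub_left]
    have hne : 1 - κ * inner ℝ e x₀ ≠ 0 := by linarith
    field_simp
    ring
  · refine IsBigO.of_bound (κ * c₂ / (1 - κ) * 2) ?_
    filter_upwards [hnear] with X hX
    have h1 := abs_refractor_sub_le hκ0 hκ1 hc₁ hΩ hu hX.1 hx₀
    have hc20 : 0 < c₂ := hc₁.trans hc₂
    rw [hv₀, radialExt, Real.norm_eq_abs, mul_assoc]
    exact h1.trans (mul_le_mul_of_nonneg_left (hdist X hX.2) (by positivity))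
  · have hb : (fun X => (radialExt u X + κ * ‖Y₀ - radialExt u X • dir X‖) -
        (radialExt u x₀ + κ * ‖Y₀ - radialExt u x₀ • dir x₀‖)) =O[𝓝 x₀]
        fun X => ‖X - x₀‖ * ‖dir X - x₀‖ ^ γ := by
      refine IsBigO.of_bound (Cx * Ch * 2) ?_
      filter_upwards [hnear] with X hX
      obtain ⟨Y, hY⟩ := hu.2 _ hX.1
      have hdx₀ : dir x₀ ∈ Ω := by rw [hdx]; exact hx₀
      rw [hΦG X hX.1, hΦG x₀ hdx₀, hdx]
      have h1 := ((mem_subdiff_iff hκ0 hκ1 hc₁ hΩ hu.1).1 hY₀).2 _ hX.1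
      have h2 := hcross _ hX.1 x₀ hx₀ Y hY Y₀ hY₀
      have h3 := hCh x₀ rfl _ hX.1 Y₀ hY₀ Y hY
      rw [norm_sub_rev, norm_sub_rev x₀] at h3
      have h4 := hdist X hX.2
      rw [Real.norm_of_nonneg (by linarith), Real.norm_of_nonneg (by positivity)]
      calc _ ≤ Cx * (‖dir X - x₀‖ * ‖Y - Y₀‖) := by linarith
        _ ≤ Cx * ((2 * ‖X - x₀‖) * (Ch * ‖dir X - x₀‖ ^ γ)) := by gcongr
        _ = _ := by ring
    refine hb.trans_isLittleO ?_
    have hz : Tendsto (fun X => ‖dir X - x₀‖ ^ γ) (𝓝 x₀) (𝓝 0) := by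
      have h1 : Tendsto (fun X => ‖dir X - x₀‖) (𝓝 x₀) (𝓝 0) := by
        have := (hDd.continuousAt.sub (continuousAt_const (y := x₀))).norm
        simpa [ContinuousAt, hdx] using this
      have := h1.rpow_const (p := γ) (Or.inr hγ0.le)
      rwa [Real.zero_rpow hγ0.ne'] at this
    have h2 := (isBigO_refl (fun X : Rn n => ‖X - x₀‖) (𝓝 x₀)).mul_isLittleO
      ((isLittleO_one_iff ℝ).2 hz)
    simp only [mul_one] at h2
    exact h2.of_norm_right

lemma norm_refractorGradient_sub_le (hκ0 : 0 < κ) (hκ1 : κ < 1) {r r' : ℝ} (hr' : 0 ≤ r')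
    (hr : 0 ≤ r) (hrc : r ≤ c₂) (hrc' : r' ≤ c₂) {x x' e e' : Rn n} (hx : ‖x‖ = 1)
    (hx' : ‖x'‖ = 1) (he : ‖e‖ = 1) (he' : ‖e'‖ = 1) :
    ‖refractorGradient κ r x e - refractorGradient κ r' x' e'‖ ≤
      (2 / (1 - κ) + 4 * c₂ / (1 - κ) ^ 2) * (|r - r'| + ‖x - x'‖ + ‖e - e'‖) := by
  obtain ⟨hk, hq⟩ := refraction_denominator_pos hκ0 hκ1 hx he
  obtain ⟨-, hq'⟩ := refraction_denominator_pos hκ0 hκ1 hx' he'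
  have ht : |inner ℝ e x - inner ℝ e' x'| ≤ ‖x - x'‖ + ‖e - e'‖ := by
    have : (inner ℝ e x : ℝ) - inner ℝ e' x' = inner ℝ e (x - x') + inner ℝ (e - e') x' := by
      rw [inner_sub_right, inner_sub_left]; ring
    rw [this]
    refine (abs_add_le _ _).trans (add_le_add ?_ ?_)
    · simpa [he] using abs_real_inner_le_norm e (x - x')
    · simpa [hx'] using abs_real_inner_le_norm (e - e') x'
  have ht1 : |inner ℝ e x| ≤ (1 : ℝ) := by simpa [he, hx] using abs_real_inner_le_norm e x
  have ht1' : |inner ℝ e' x'| ≤ (1 : ℝ) := by simpa [he', hx'] using abs_real_inner_le_norm e' x'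
  unfold refractorGradient
  set t : ℝ := inner ℝ e x
  set t' : ℝ := inner ℝ e' x'
  set q := 1 - κ * t with hqd
  set q' := 1 - κ * t' with hqd'
  set a := ‖x - x'‖
  set b := ‖e - e'‖
  set d := |r - r'|
  have ha0 : 0 ≤ a := norm_nonneg _
  have hb0 : 0 ≤ b := norm_nonneg _
  have hd0 : 0 ≤ d := abs_nonneg _
  have hq0 : 0 < q := hk.trans_le hq
  have hq0' : 0 < q' := hk.trans_le hq'
  have hc0 : 0 ≤ c₂ := hr.trans hrc
  have hvec : ‖(e - t • x) - (e' - t' • x')‖ ≤ 2 * (a + b) := by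
    have : (e - t • x) - (e' - t' • x') = (e - e') - ((t - t') • x + t' • (x - x')) := by module
    rw [this]
    refine (norm_sub_le _ _).trans ?_
    have h1 : ‖(t - t') • x + t' • (x - x')‖ ≤ (a + b) + a := by
      refine (norm_add_le _ _).trans (add_le_add ?_ ?_)
      · rw [norm_smul, hx, mul_one]; exact ht
      · rw [norm_smul]; exact mul_le_of_le_one_left ha0 ht1'
    linarith
  have hvec' : ‖e - t • x‖ ≤ 2 := by
    refine (norm_sub_le _ _).trans ?_
    rw [norm_smul, he, hx, mul_one, Real.norm_eq_abs]
    linarith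
  have hcoef' : |κ * r' / q'| ≤ c₂ / (1 - κ) := by
    rw [abs_of_nonneg (by positivity)]
    have : κ * r' ≤ c₂ := by nlinarith
    gcongr
  have hcoef : |κ * r / q - κ * r' / q'| ≤ d / (1 - κ) + c₂ / (1 - κ) ^ 2 * (a + b) := by
    have h1 : κ * r / q - κ * r' / q' = κ * (r - r') / q + κ * r' * (κ * (t - t')) / (q * q') := by
      rw [div_sub_div _ _ hq0.ne' hq0'.ne', div_add_div _ _ hq0.ne' (by positivity),
        div_eq_div_iff (by positivity) (by positivity), hqd, hqd']
      ring
    rw [h1]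
    refine (abs_add_le _ _).trans (add_le_add ?_ ?_)
    · rw [abs_div, abs_of_pos hq0, abs_mul, abs_of_pos hκ0]
      have : κ * |r - r'| ≤ d := mul_le_of_le_one_left hd0 hκ1.le
      gcongr
    · rw [abs_div, abs_of_pos (mul_pos hq0 hq0'), abs_mul, abs_mul κ (t - t'), abs_of_pos hκ0,
        abs_of_nonneg (by positivity : 0 ≤ κ * r'), div_mul_eq_mul_div]
      have h2 : κ * r' ≤ c₂ := by nlinarith
      have h3 : κ * |t - t'| ≤ a + b := (mul_le_of_le_one_left (abs_nonneg _) hκ1.le).trans ht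
      have h4 : (1 - κ) ^ 2 ≤ q * q' := by rw [sq]; gcongr
      gcongr
  have hdec : (κ * r / q) • (e - t • x) - (κ * r' / q') • (e' - t' • x') =
      (κ * r / q - κ * r' / q') • (e - t • x) +
        (κ * r' / q') • ((e - t • x) - (e' - t' • x')) := by module
  rw [hdec]
  refine (norm_add_le _ _).trans ?_
  rw [norm_smul, norm_smul, Real.norm_eq_abs, Real.norm_eq_abs]
  have m1 : |κ * r / q - κ * r' / q'| * ‖e - t • x‖ ≤
      (d / (1 - κ) + c₂ / (1 - κ) ^ 2 * (a + b)) * 2 :=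
    mul_le_mul hcoef hvec' (norm_nonneg _) (by positivity)
  have m2 : |κ * r' / q'| * ‖(e - t • x) - (e' - t' • x')‖ ≤ c₂ / (1 - κ) * (2 * (a + b)) :=
    mul_le_mul hcoef' hvec (norm_nonneg _) (by positivity)
  have m3 : c₂ / (1 - κ) ≤ c₂ / (1 - κ) ^ 2 := by
    apply div_le_div_of_nonneg_left hc0 (by positivity)
    nlinarith
  have m4 : c₂ / (1 - κ) * (2 * (a + b)) ≤ c₂ / (1 - κ) ^ 2 * (2 * (a + b)) := by gcongr
  have m5 : 0 ≤ 2 / (1 - κ) * (a + b) := by positivity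
  have m6 : 0 ≤ c₂ / (1 - κ) ^ 2 * d := by positivity
  have : (2 / (1 - κ) + 4 * c₂ / (1 - κ) ^ 2) * (d + a + b) =
      2 * (d / (1 - κ)) + 4 * (c₂ / (1 - κ) ^ 2 * (a + b)) + 2 / (1 - κ) * (a + b) +
        4 * (c₂ / (1 - κ) ^ 2 * d) := by ring
  rw [this]
  linarith

/-- All ingredients of the gradient formula are Lipschitz in `x` except the supporting point, whose
Hölder exponent therefore decides; distances on the sphere are at most `2`, so Lipschitz terms are
absorbed by `δ ≤ 2 δ^γ`. -/
theorem IsRefractor.c1HolderLoc (hn : 2 ≤ n) (hκ0 : 0 < κ) (hκ1 : κ < 1) (hc₁ : 0 < c₁)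
    (hc₂ : c₁ < c₂) {U : Set (Rn n)} (hU : IsOpen U) (hΩU : Ω = U ∩ unitSphere n)
    (hA : HypA κ c₁ c₂ Ω S E s) (hB : HypB κ c₁ c₂ Ω S) (hC : HypC κ c₁ c₂ Ω E s)
    (hD : HypD κ c₁ c₂ Ω S s) (hu : IsRefractor κ c₁ c₂ Ω S u) (hM : MeasureCondition κ Ω S u) :
    C1HolderLoc (1 / (4 * (n : ℝ) - 5)) Ω u := by
  have hΩ : Ω ⊆ unitSphere n := hΩU ▸ inter_subset_right
  have hder : ∀ x ∈ Ω, ∀ Y ∈ subdiff κ Ω S u x, HasFDerivAt (radialExt u)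
      (innerSL ℝ (refractorGradient κ (u x) x (dir (Y - u x • x)))) x := fun x hx Y hY =>
    hasFDerivAt_radialExt hn hκ0 hκ1 hc₁ hc₂ hU hΩU hA hB hC hD hu hM hx hY
  refine ⟨fun x hx => ?_, fun K hKΩ hK => ?_⟩
  · obtain ⟨Y, hY⟩ := hu.2 x hx
    exact (hder x hx Y hY).differentiableAt
  obtain ⟨Ch, hCh0, hCh⟩ := exists_subdiff_holder hn hκ0 hκ1 hc₁ hc₂ hU hΩU hA hB hC hD hu hM
    hK hKΩ
  have hc20 : 0 < c₂ := hc₁.trans hc₂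
  have hk : 0 < 1 - κ := by linarith
  have hn' : (2 : ℝ) ≤ n := by exact_mod_cast hn
  have hγ0 : 0 < 1 / (4 * (n : ℝ) - 5) := by apply one_div_pos.2; linarith
  have hγ1 : 1 / (4 * (n : ℝ) - 5) ≤ 1 := by rw [div_le_one (by linarith)]; linarith
  set γ := 1 / (4 * (n : ℝ) - 5) with hγ
  set Λ := κ * c₂ / (1 - κ) with hΛ
  have hΛ0 : 0 ≤ Λ := by positivity
  set ℓ := 2 / (2 * (c₂ / κ)) with hℓ
  have hℓ0 : 0 ≤ ℓ := by positivity
  set A := 2 / (1 - κ) + 4 * c₂ / (1 - κ) ^ 2 with hAd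
  have hA0 : 0 ≤ A := by positivity
  refine ⟨A * ((Λ + 1 + ℓ * (Λ + c₂)) * 2 + ℓ * Ch), fun x hxK y hyK => ?_⟩
  have hx := hKΩ hxK
  have hy := hKΩ hyK
  obtain ⟨Y, hY⟩ := hu.2 x hx
  obtain ⟨Z, hZ⟩ := hu.2 y hy
  rw [(hder x hx Y hY).fderiv, (hder y hy Z hZ).fderiv, ← map_sub, innerSL_apply_norm]
  have hx1 := norm_eq_one_of_mem_unitSphere (hΩ hx)
  have hy1 := norm_eq_one_of_mem_unitSphere (hΩ hy)
  have hXx := smul_mem_Gam hx (hu.1 x hx)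
  have hXy := smul_mem_Gam hy (hu.1 y hy)
  have hpx := (hA.direction hXx hY.1).2.2
  have hpy := (hA.direction hXy hZ.1).2.2
  have hgrad := norm_refractorGradient_sub_le hκ0 hκ1 (hc₁.le.trans (hu.1 y hy).1)
    (hc₁.le.trans (hu.1 x hx).1) (hu.1 x hx).2 (hu.1 y hy).2 hx1 hy1 (norm_dir hpx)
    (norm_dir hpy)
  have hr := abs_refractor_sub_le hκ0 hκ1 hc₁ hΩ hu hx hy
  have hX := norm_refractor_smul_sub_le hκ0 hκ1 hc₁ hΩ hu hx hy
  have hL := hCh x hxK y hy Y hY Z hZ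
  have hδ2 : ‖x - y‖ ≤ 2 := by
    refine (norm_sub_le _ _).trans ?_
    rw [hx1, hy1]; norm_num
  set δ := ‖x - y‖ with hδ
  have hδ0 : 0 ≤ δ := norm_nonneg _
  have he : ‖dir (Y - u x • x) - dir (Z - u y • y)‖ ≤ ℓ * (Ch * δ ^ γ + (Λ + c₂) * δ) := by
    refine (norm_dir_sub_le hpx hpy).trans ?_
    have h1 := le_norm_sub_of_hypB hκ0 hc₁ hc₂ hΩ hA hB hXx hY.1
    have h2 : ‖Y - u x • x - (Z - u y • y)‖ ≤ ‖Y - Z‖ + ‖u x • x - u y • y‖ := by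
      have : Y - u x • x - (Z - u y • y) = (Y - Z) - (u x • x - u y • y) := by abel
      rw [this]; exact norm_sub_le _ _
    refine mul_le_mul ?_ (h2.trans (add_le_add hL hX)) (norm_nonneg _) hℓ0
    rw [hℓ]
    gcongr
  have hδγ : δ ≤ 2 * δ ^ γ := le_two_mul_rpow hδ0 hδ2 hγ0 hγ1
  refine hgrad.trans ?_
  rw [mul_assoc]
  refine mul_le_mul_of_nonneg_left ?_ hA0
  have h3 : (Λ + 1 + ℓ * (Λ + c₂)) * δ ≤ (Λ + 1 + ℓ * (Λ + c₂)) * (2 * δ ^ γ) := by gcongr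
  have h4 : |u x - u y| + δ + ‖dir (Y - u x • x) - dir (Z - u y • y)‖ ≤
      Λ * δ + δ + ℓ * (Ch * δ ^ γ + (Λ + c₂) * δ) := by linarith
  linarith

end

end NearField

end

theorem theorem5p6 (n : ℕ) (hn : 2 ≤ n) (κ c₁ c₂ : ℝ) (hκ0 : 0 < κ) (hκ1 : κ < 1)
    (hc₁ : 0 < c₁) (hc₂ : c₁ < c₂)
    (Ω S : Set (NearField.Rn n))
    (hΩ : ∃ U : Set (NearField.Rn n), IsOpen U ∧ Ω = U ∩ NearField.unitSphere n)
    (hΩconn : IsPreconnected Ω)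
    (hS : MeasurableSet S)
    (E : NearField.Rn n → Set (NearField.Rn n))
    (s : NearField.Rn n → NearField.Rn n → ℝ)
    (hA : NearField.HypA κ c₁ c₂ Ω S E s)
    (hB : NearField.HypB κ c₁ c₂ Ω S)
    (hC : NearField.HypC κ c₁ c₂ Ω E s)
    (hD : NearField.HypD κ c₁ c₂ Ω S s)
    (hdiff : NearField.DifferentiableSurface S)
    (f : NearField.Rn n → ℝ)
    (hf_pos : ∀ᵐ x ∂((NearField.hausdorff n).restrict Ω), 0 < f x)
    (hf_bdd : MemLp f ∞ ((NearField.hausdorff n).restrict Ω))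
    (ν : Measure (NearField.Rn n))
    (hν_supp : ν Sᶜ = 0)
    (hν_ac : ν ≪ NearField.hausdorff n)
    (g : NearField.Rn n → ℝ) (hg_meas : Measurable g) (α : ℝ)
    (hg_bdd : ∀ᵐ y ∂((NearField.hausdorff n).restrict S), 0 ≤ g y ∧ g y ≤ α)
    (hg : (NearField.hausdorff n).restrict S = ν.withDensity (fun y => ENNReal.ofReal (g y)))
    (u : NearField.Rn n → ℝ)
    (hu : NearField.IsWeakSolution κ c₁ c₂ Ω S f ν u) :
    NearField.MeasureCondition κ Ω S u ∧
      NearField.C1HolderLoc (1 / (4 * (n : ℝ) - 5)) Ω u := by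
  obtain ⟨U, hU, hΩU⟩ := hΩ
  have hΩs : Ω ⊆ NearField.unitSphere n := hΩU ▸ inter_subset_right
  have hM := hu.measureCondition (by omega) hκ0 hκ1 hc₁ hc₂ hΩs hΩconn hS hA hB hf_bdd hν_ac
    hg_meas hg_bdd hg
  exact ⟨hM, hu.1.c1HolderLoc hn hκ0 hκ1 hc₁ hc₂ hU hΩU hA hB hC hD hM⟩
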